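/- For $n\ge 1$ let $\Delta_n$ be the set of probability distributions on $[n]=\{1,\dots,n\}$. For $q_1,q_2\in\Delta_n$ put $\Pi_{q_1,q_2}=\{(1-\alpha)q_1+\alpha q_2:\alpha\in[0,1]\}$, and call $p\in\Delta_n$ *$\epsilon$-far* from $\Pi_{q_1,q_2}$ if $\|p-r\|_1\ge\epsilon$ for every $r\in\Pi_{q_1,q_2}$. A *closeness tester in the presence of noise accessible via samples*, with proximity parameter $\epsilon$, is a (possibly randomized) algorithm that receives $m_0$, $m_1$, $m_2$ independent samples from unknown distributions $p$, $q_1$, $q_2\in\Delta_n$ respectively and satisfies, for all $p,q_1,q_2\in\Delta_n$: if $p\in\Pi_{q_1,q_2}$ it accepts with probability at least $2/3$, and if $p$ is $\epsilon$-far from $\Pi_{q_1,q_2}$ it rejects with probability at least $2/3$. The number of samples it uses is $m_0+m_1+m_2$. The number of samples needed for this task is $\Theta\left(\sqrt n/\epsilon^2+n^{2/3}/\epsilon^{4/3}\right)$. Precisely, there are universal constants $c,C>0$ such that: (i) for all $n\ge1$ and $\epsilon>0$ there is such a tester that uses at most $C\left(\sqrt n/\epsilon^2+n^{2/3}/\epsilon^{4/3}\right)$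 samples; (ii) for all $n\ge2$ and $0<\epsilon\le1$, every such tester uses at least $c\left(\sqrt n/\epsilon^2+n^{2/3}/\epsilon^{4/3}\right)$ samples. -/

import Mathlib

namespace MixtureTesting

noncomputable section

/-- A probability distribution on a domain with `n` elements. -/
abbrev Dist (n : ℕ) : Type := stdSimplex ℝ (Fin n)

/-- The `ℓ₁`-distance between two distributions. -/
def l1Dist {n : ℕ} (p q : Dist n) : ℝ := ∑ i, |p.1 i - q.1 i|

/-- The set of all mixtures `(1 - α) q₁ + α q₂` with `α ∈ [0, 1]`. -/
def mixtures {n : ℕ} (q₁ q₂ : Dist n) : Set (Dist n) :=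
  {r | ∃ α : ℝ, 0 ≤ α ∧ α ≤ 1 ∧ ∀ i, r.1 i = (1 - α) * q₁.1 i + α * q₂.1 i}

/-- `p` is `ε`-far from every member of the property `P`. -/
def IsFar {n : ℕ} (ε : ℝ) (p : Dist n) (P : Set (Dist n)) : Prop :=
  ∀ r ∈ P, ε ≤ l1Dist p r

/-- The probability that `m` independent samples from `p` are exactly `x 0, …, x (m - 1)`. -/
def sampleProb {n m : ℕ} (p : Dist n) (x : Fin m → Fin n) : ℝ := ∏ j, p.1 (x j)

/-- A randomized algorithm which sees `m₀` samples from the first distribution, `m₁` from the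
second and `m₂` from the third, and then accepts or rejects; the value is the probability
(over the internal randomness) of accepting on the given samples. -/
abbrev Algorithm (n m₀ m₁ m₂ : ℕ) : Type :=
  (Fin m₀ → Fin n) → (Fin m₁ → Fin n) → (Fin m₂ → Fin n) → unitInterval

/-- The probability, over independent samples from `p`, `q₁`, `q₂` and the internal randomness,
that the algorithm accepts. -/
def acceptProb {n m₀ m₁ m₂ : ℕ} (T : Algorithm n m₀ m₁ m₂) (p q₁ q₂ : Dist n) : ℝ :=
  ∑ x : Fin m₀ → Fin n, ∑ y : Fin m₁ → Fin n, ∑ z : Fin m₂ → Fin n,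
    sampleProb p x * sampleProb q₁ y * sampleProb q₂ z * (T x y z : ℝ)

/-- The algorithm is a closeness tester in the presence of noise that is accessible via samples:
for all `p`, `q₁`, `q₂` it accepts with probability at least `2/3` if `p` is a mixture of `q₁` and
`q₂`, and rejects with probability at least `2/3` if `p` is `ε`-far from all such mixtures. -/
def IsMixtureTester {n m₀ m₁ m₂ : ℕ} (ε : ℝ) (T : Algorithm n m₀ m₁ m₂) : Prop :=
  ∀ p q₁ q₂ : Dist n,
    (p ∈ mixtures q₁ q₂ → 2 / 3 ≤ acceptProb T p q₁ q₂) ∧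
    (IsFar ε p (mixtures q₁ q₂) → 2 / 3 ≤ 1 - acceptProb T p q₁ q₂)

/-- The rate `√n / ε² + n^(2/3) / ε^(4/3)`. -/
def rate (n : ℕ) (ε : ℝ) : ℝ :=
  √(n : ℝ) / ε ^ 2 + (n : ℝ) ^ (2 / 3 : ℝ) / ε ^ (4 / 3 : ℝ)

end

end MixtureTesting

/-! Upper bound. Samples are taken in triples, one from each of p, q₁, q₂. The first k triples
flatten: element i is split into bᵢ buckets, one plus its number of occurrences. In the inner
product with weights 1/bᵢ the squared norms of p, q₁, q₂ have expected total at most 3/(k+1)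
(`expect_flattened_le`), while Cauchy–Schwarz with ∑ bᵢ = n + 3k turns ℓ₁-distance ε into squared
weighted distance at least h = ε²/(n + 3k). Two further independent batches of m triples give
unbiased bilinear estimates of all the inner products needed (`stat_variance`).

The squared distance from p to the mixture of weight x is quadratic in x, and so is its estimate;
the tester accepts if the estimate drops to h/2 somewhere on [0, 1]. No union bound over x is
needed: the distance grows quadratically away from the closest mixture (`exists_closest_mixture`),
and four Chebyshev bounds control the coefficients of the estimate relative to that growth
(`accept_prob_le`). Taking k = min(n, ⌊n^(2/3)/ε^(4/3)⌋) balances the two phases.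

Lower bound. When q₁ = q₂ the segment is a point, so a tester also tests closeness. The term √n/ε²
comes from randomly signed pairwise perturbations of a uniform distribution and a second moment
computation (`sqrt_lower_bound`). For n^(2/3)/ε^(4/3), few heavy elements are mixed with many light
ones, which are either shared by p and q or owned by only one of them. The light elements can be
told apart only through collisions, and those of the heavy elements mask them. Poisson sample
lengths make the elements independent, so that χ²-divergences of single elements can be combined
(`poisson_mixtures_close`, `cellSum_chiSq_le`, `no_tester_of_few_samples`). -/

namespace MixtureTesting

/-! ### Moments of i.i.d. sums and of bilinear statistics -/

/-- Summing over sequences of length `m + 1` is summing over the first entry and the rest. -/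
theorem sum_fin_succ_fun {Ω : Type*} [Fintype Ω] {m : ℕ} (f : (Fin (m + 1) → Ω) → ℝ) :
    ∑ ω, f ω = ∑ a, ∑ ω : Fin m → Ω, f (Fin.cons a ω) := by
  rw [← (Fin.consEquiv (fun _ : Fin (m + 1) => Ω)).sum_comp, Fintype.sum_prod_type]
  rfl

theorem sum_prod_weight {Ω : Type*} [Fintype Ω] {μ : Ω → ℝ} (hμ : ∑ a, μ a = 1) (m : ℕ) :
    ∑ ω : Fin m → Ω, ∏ j, μ (ω j) = 1 := by
  rw [← Fintype.sum_pow, hμ, one_pow]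

theorem iid_first_moment {Ω : Type*} [Fintype Ω] {μ : Ω → ℝ} (hμ : ∑ a, μ a = 1)
    (g : Ω → ℝ) (m : ℕ) :
    ∑ ω : Fin m → Ω, (∏ j, μ (ω j)) * ∑ j, g (ω j) = m * ∑ a, μ a * g a := by
  induction m with
  | zero => simp
  | succ m ih =>
    rw [sum_fin_succ_fun]
    simp only [Fin.prod_univ_succ, Fin.sum_univ_succ, Fin.cons_zero, Fin.cons_succ]
    have h : ∀ a, ∑ ω : Fin m → Ω, μ a * (∏ j, μ (ω j)) * (g a + ∑ j, g (ω j))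
        = μ a * g a + μ a * (m * ∑ a, μ a * g a) := by
      intro a
      rw [← ih, Finset.mul_sum]
      have : μ a * g a = ∑ ω : Fin m → Ω, (μ a * g a) * ∏ j, μ (ω j) := by
        rw [← Finset.mul_sum, sum_prod_weight hμ, mul_one]
      rw [this, ← Finset.sum_add_distrib]
      exact Finset.sum_congr rfl fun ω _ => by ring
    simp only [h]
    rw [Finset.sum_add_distrib, ← Finset.sum_mul, hμ]
    push_cast; ring

theorem iid_second_moment {Ω : Type*} [Fintype Ω] {μ : Ω → ℝ} (hμ : ∑ a, μ a = 1)
    (g : Ω → ℝ) (m : ℕ) :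
    ∑ ω : Fin m → Ω, (∏ j, μ (ω j)) * (∑ j, g (ω j)) ^ 2
      = m * ∑ a, μ a * g a ^ 2 + m * (m - 1) * (∑ a, μ a * g a) ^ 2 := by
  induction m with
  | zero => simp
  | succ m ih =>
    rw [sum_fin_succ_fun]
    simp only [Fin.prod_univ_succ, Fin.sum_univ_succ, Fin.cons_zero, Fin.cons_succ]
    have h : ∀ a, ∑ ω : Fin m → Ω, μ a * (∏ j, μ (ω j)) * (g a + ∑ j, g (ω j)) ^ 2
        = μ a * g a ^ 2 + 2 * (m * ∑ a, μ a * g a) * (μ a * g a) + μ a *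
          (m * ∑ a, μ a * g a ^ 2 + m * (m - 1) * (∑ a, μ a * g a) ^ 2) := by
      intro a
      rw [← ih, ← iid_first_moment hμ, Finset.mul_sum]
      have : μ a * g a ^ 2 = ∑ ω : Fin m → Ω, (μ a * g a ^ 2) * ∏ j, μ (ω j) := by
        rw [← Finset.mul_sum, sum_prod_weight hμ, mul_one]
      rw [this, Finset.mul_sum, Finset.sum_mul, ← Finset.sum_add_distrib,
        ← Finset.sum_add_distrib]
      exact Finset.sum_congr rfl fun ω _ => by ring
    simp only [h]
    rw [Finset.sum_add_distrib, Finset.sum_add_distrib, ← Finset.sum_mul, ← Finset.mul_sum, hμ]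
    push_cast; ring

/-- First moment of the bilinear statistic `∑ⱼₖ K(ωⱼ, ω'ₖ)` of two independent i.i.d. samples. -/
theorem bilinear_first_moment {Ω : Type*} [Fintype Ω] {μ : Ω → ℝ} (hμ : ∑ a, μ a = 1)
    (K : Ω → Ω → ℝ) (m : ℕ) :
    ∑ ω' : Fin m → Ω, (∏ j, μ (ω' j)) * ∑ ω : Fin m → Ω, (∏ j, μ (ω j)) *
        (∑ j, ∑ k, K (ω j) (ω' k))
      = m ^ 2 * ∑ a, μ a * ∑ b, μ b * K a b := by
  have h1 : ∀ ω' : Fin m → Ω, ∑ ω : Fin m → Ω, (∏ j, μ (ω j)) * (∑ j, ∑ k, K (ω j) (ω' k))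
      = ∑ k, m * ∑ a, μ a * K a (ω' k) := by
    intro ω'
    rw [iid_first_moment hμ (fun a => ∑ k, K a (ω' k)) m, ← Finset.mul_sum, Finset.sum_comm]
    simp only [Finset.mul_sum]
  simp only [h1]
  rw [iid_first_moment hμ (fun b => m * ∑ a, μ a * K a b) m]
  simp only [Finset.mul_sum]
  rw [Finset.sum_comm]
  exact Finset.sum_congr rfl fun a _ => Finset.sum_congr rfl fun b _ => by ring

/-- Second moment of the bilinear statistic `∑ⱼₖ K(ωⱼ, ω'ₖ)` of two independent i.i.d. samples. -/
theorem bilinear_second_moment {Ω : Type*} [Fintype Ω] {μ : Ω → ℝ} (hμ : ∑ a, μ a = 1)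
    (K : Ω → Ω → ℝ) (m : ℕ) :
    ∑ ω' : Fin m → Ω, (∏ j, μ (ω' j)) * ∑ ω : Fin m → Ω, (∏ j, μ (ω j)) *
        (∑ j, ∑ k, K (ω j) (ω' k)) ^ 2
      = m ^ 2 * ∑ a, μ a * ∑ b, μ b * K a b ^ 2
        + m ^ 2 * (m - 1) * ∑ a, μ a * (∑ b, μ b * K a b) ^ 2
        + m ^ 2 * (m - 1) * ∑ b, μ b * (∑ a, μ a * K a b) ^ 2
        + m ^ 2 * (m - 1) ^ 2 * (∑ a, μ a * ∑ b, μ b * K a b) ^ 2 := by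
  have h1 : ∀ ω' : Fin m → Ω,
      (∏ j, μ (ω' j)) * ∑ ω : Fin m → Ω, (∏ j, μ (ω j)) * (∑ j, ∑ k, K (ω j) (ω' k)) ^ 2
      = m * ∑ a, μ a * ((∏ j, μ (ω' j)) * (∑ k, K a (ω' k)) ^ 2)
        + m * (m - 1) * ((∏ j, μ (ω' j)) * (∑ k, ∑ a, μ a * K a (ω' k)) ^ 2) := by
    intro ω'
    rw [iid_second_moment hμ (fun a => ∑ k, K a (ω' k)) m]
    have : ∑ k, ∑ a, μ a * K a (ω' k) = ∑ a, μ a * ∑ k, K a (ω' k) := by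
      rw [Finset.sum_comm]; simp only [Finset.mul_sum]
    rw [this, mul_add, Finset.mul_sum, Finset.mul_sum, Finset.mul_sum]
    congr 1
    · exact Finset.sum_congr rfl fun a _ => by ring
    · ring
  simp only [h1]
  rw [Finset.sum_add_distrib, ← Finset.mul_sum, ← Finset.mul_sum, Finset.sum_comm,
    iid_second_moment hμ (fun b => ∑ a, μ a * K a b) m]
  simp only [← Finset.mul_sum]
  have h2 : ∑ a, μ a * ∑ ω' : Fin m → Ω, (∏ j, μ (ω' j)) * (∑ k, K a (ω' k)) ^ 2
      = m * (∑ a, μ a * ∑ b, μ b * K a b ^ 2)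
        + m * (m - 1) * ∑ a, μ a * (∑ b, μ b * K a b) ^ 2 := by
    simp only [iid_second_moment hμ, mul_add, Finset.sum_add_distrib]
    congr 1 <;> rw [Finset.mul_sum] <;> exact Finset.sum_congr rfl fun a _ => by ring
  have h3 : ∑ b, μ b * ∑ a, μ a * K a b = ∑ a, μ a * ∑ b, μ b * K a b := by
    simp only [Finset.mul_sum]
    rw [Finset.sum_comm]
    exact Finset.sum_congr rfl fun a _ => Finset.sum_congr rfl fun b _ => by ring
  rw [h2, h3]
  ring

/-- Variance bound for the bilinear statistic `∑ⱼₖ K(ωⱼ, ω'ₖ)`. -/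
theorem bilinear_variance {Ω : Type*} [Fintype Ω] {μ : Ω → ℝ} (hμ0 : ∀ a, 0 ≤ μ a)
    (hμ : ∑ a, μ a = 1) (K : Ω → Ω → ℝ) {m : ℕ} (hm : 1 ≤ m) :
    ∑ ω' : Fin m → Ω, (∏ j, μ (ω' j)) * ∑ ω : Fin m → Ω, (∏ j, μ (ω j)) *
        ((∑ j, ∑ k, K (ω j) (ω' k)) - m ^ 2 * ∑ a, μ a * ∑ b, μ b * K a b) ^ 2
      ≤ m ^ 2 * ∑ a, μ a * ∑ b, μ b * K a b ^ 2
        + m ^ 3 * (∑ a, μ a * (∑ b, μ b * K a b) ^ 2 + ∑ b, μ b * (∑ a, μ a * K a b) ^ 2) := by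
  set κ := ∑ a, μ a * ∑ b, μ b * K a b with hκ
  have h1 : ∀ (S : (Fin m → Ω) → (Fin m → Ω) → ℝ) (c : ℝ),
      ∑ ω' : Fin m → Ω, (∏ j, μ (ω' j)) * ∑ ω : Fin m → Ω, (∏ j, μ (ω j)) * (S ω ω' - c) ^ 2
      = (∑ ω' : Fin m → Ω, (∏ j, μ (ω' j)) * ∑ ω : Fin m → Ω, (∏ j, μ (ω j)) * (S ω ω') ^ 2)
        - 2 * c * (∑ ω' : Fin m → Ω, (∏ j, μ (ω' j)) * ∑ ω : Fin m → Ω, (∏ j, μ (ω j)) *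
          S ω ω') + c ^ 2 := by
    intro S c
    have h2 : c ^ 2 = ∑ ω' : Fin m → Ω, (∏ j, μ (ω' j)) * ∑ ω : Fin m → Ω,
        (∏ j, μ (ω j)) * c ^ 2 := by
      rw [← Finset.sum_mul, sum_prod_weight hμ, ← Finset.sum_mul, sum_prod_weight hμ]; ring
    rw [h2]
    simp only [Finset.mul_sum, ← Finset.sum_sub_distrib, ← Finset.sum_add_distrib]
    exact Finset.sum_congr rfl fun a _ => Finset.sum_congr rfl fun b _ => by ring
  rw [h1, bilinear_second_moment hμ, bilinear_first_moment hμ, ← hκ]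
  have hA : 0 ≤ ∑ a, μ a * (∑ b, μ b * K a b) ^ 2 :=
    Finset.sum_nonneg fun a _ => mul_nonneg (hμ0 a) (sq_nonneg _)
  have hB : 0 ≤ ∑ b, μ b * (∑ a, μ a * K a b) ^ 2 :=
    Finset.sum_nonneg fun a _ => mul_nonneg (hμ0 a) (sq_nonneg _)
  have hm' : (1 : ℝ) ≤ m := by exact_mod_cast hm
  -- Subtracting m⁴κ² from the exact second moment leaves -m²(2m - 1)κ², and m²(m - 1) falls short
  -- of m³ by m²; `h4` and `h5` are these discarded terms.
  have h4 : (0 : ℝ) ≤ (m : ℝ) ^ 2 * κ ^ 2 * (2 * m - 1) := by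
    have : (0 : ℝ) ≤ 2 * m - 1 := by linarith
    positivity
  have h5 : (0 : ℝ) ≤ (m : ℝ) ^ 2 * ((∑ a, μ a * (∑ b, μ b * K a b) ^ 2)
    + ∑ b, μ b * (∑ a, μ a * K a b) ^ 2) := by positivity
  nlinarith [h4, h5]

/-- If the event `E` has probability `q`, and `c` counts its occurrences among `k` samples, then
`q 𝔼[1 / (1 + c)] ≤ 1 / (k + 1)`. -/
theorem expect_inv_count_le {Ω : Type*} [Fintype Ω] {μ : Ω → ℝ} (hμ0 : ∀ a, 0 ≤ μ a)
    (hμ : ∑ a, μ a = 1) (E : Ω → Prop) [DecidablePred E] (k : ℕ) :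
    (∑ a, μ a * if E a then 1 else 0) * ∑ x : Fin k → Ω, (∏ j, μ (x j)) *
        (1 + ∑ j, if E (x j) then (1 : ℝ) else 0)⁻¹ ≤ 1 / (k + 1) := by
  -- Exchangeability among k + 1 samples: singling out any one coordinate that hits E leaves a count
  -- 1 + c over the other k, so the value does not depend on j₀.
  have key : ∀ j₀ : Fin (k + 1), ∑ x : Fin (k + 1) → Ω, (∏ j, μ (x j)) *
      ((if E (x j₀) then 1 else 0) * (∑ j, if E (x j) then (1 : ℝ) else 0)⁻¹)
      = (∑ a, μ a * if E a then 1 else 0) * ∑ x : Fin k → Ω, (∏ j, μ (x j)) *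
        (1 + ∑ j, if E (x j) then (1 : ℝ) else 0)⁻¹ := by
    intro j₀
    rw [← (Fin.insertNthEquiv (fun _ => Ω) j₀).sum_comp, Fintype.sum_prod_type, Finset.sum_mul]
    refine Finset.sum_congr rfl fun a _ => ?_
    rw [Finset.mul_sum]
    refine Finset.sum_congr rfl fun x _ => ?_
    rw [Fin.prod_univ_succAbove _ j₀, Fin.sum_univ_succAbove _ j₀]
    by_cases h : E a
    · simp [h, mul_assoc]
    · simp [h]
  have hsum : (k + 1 : ℝ) * ((∑ a, μ a * if E a then 1 else 0) *
      ∑ x : Fin k → Ω, (∏ j, μ (x j)) * (1 + ∑ j, if E (x j) then (1 : ℝ) else 0)⁻¹) ≤ 1 := by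
    calc (k + 1 : ℝ) * ((∑ a, μ a * if E a then 1 else 0) *
          ∑ x : Fin k → Ω, (∏ j, μ (x j)) * (1 + ∑ j, if E (x j) then (1 : ℝ) else 0)⁻¹)
        = ∑ j₀ : Fin (k + 1), ∑ x : Fin (k + 1) → Ω, (∏ j, μ (x j)) *
      ((if E (x j₀) then 1 else 0) * (∑ j, if E (x j) then (1 : ℝ) else 0)⁻¹) := by
          simp only [key]; simp
      _ ≤ ∑ x : Fin (k + 1) → Ω, ∏ j, μ (x j) := by
          rw [Finset.sum_comm]
          refine Finset.sum_le_sum fun x _ => ?_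
          rw [← Finset.mul_sum, ← Finset.sum_mul]
          -- Summed over j₀ the integrand is count · count⁻¹, which is 1, or 0 if nothing hits E.
          exact mul_le_of_le_one_right (Finset.prod_nonneg fun j _ => hμ0 _) mul_inv_le_one
      _ = 1 := sum_prod_weight hμ _
  rw [le_div_iff₀ (by positivity)]
  linarith

/-! ### The weighted inner product estimator and its variance -/

/-- The probability of a triple of independent samples, one from each of three distributions. -/
noncomputable def tripleWeight {α : Type*} (P : Fin 3 → α → ℝ) (ω : Fin 3 → α) : ℝ :=
  ∏ s, P s (ω s)

/-- The weighted inner product of `∑ₛ γₛ e_{ωₛ}` and `∑ₜ δₜ e_{ω'ₜ}`. -/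
noncomputable def kern {α : Type*} [DecidableEq α] (a : α → ℝ) (γ δ : Fin 3 → ℝ)
    (ω ω' : Fin 3 → α) : ℝ :=
  ∑ s, ∑ t, γ s * δ t * (if ω s = ω' t then a (ω s) else 0)

/-- The linear combination of three distributions with coefficients `γ`. -/
noncomputable def comb {α : Type*} (P : Fin 3 → α → ℝ) (γ : Fin 3 → ℝ) (i : α) : ℝ :=
  ∑ s, γ s * P s i

/-- The weighted inner product of two linear combinations of three distributions. -/
noncomputable def combInner {α : Type*} [Fintype α] (a : α → ℝ) (P : Fin 3 → α → ℝ)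
    (γ δ : Fin 3 → ℝ) : ℝ :=
  ∑ i, a i * (comb P γ i * comb P δ i)

/-- The empirical estimate of `combInner` from two independent batches of sample triples. -/
noncomputable def stat {α : Type*} [DecidableEq α] {m : ℕ} (a : α → ℝ) (γ δ : Fin 3 → ℝ)
    (B C : Fin m → Fin 3 → α) : ℝ :=
  (∑ j, ∑ k, kern a γ δ (B j) (C k)) / m ^ 2

theorem kern_symm {α : Type*} [DecidableEq α] {a : α → ℝ} {γ δ : Fin 3 → ℝ} (ω ω' : Fin 3 → α) :
    kern a γ δ ω ω' = kern a δ γ ω' ω := by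
  simp only [kern]
  rw [Finset.sum_comm]
  refine Finset.sum_congr rfl fun s _ => Finset.sum_congr rfl fun t _ => ?_
  by_cases h : ω t = ω' s
  · simp only [h, if_true]; ring
  · simp [h, Ne.symm h]

section
variable {α : Type*} {P : Fin 3 → α → ℝ}

theorem tripleWeight_nonneg (hP : ∀ s i, 0 ≤ P s i) (ω : Fin 3 → α) : 0 ≤ tripleWeight P ω :=
  Finset.prod_nonneg fun _ _ => hP _ _

variable [Fintype α]

theorem sum_tripleWeight (hP : ∀ s, ∑ i, P s i = 1) : ∑ ω, tripleWeight P ω = 1 := by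
  classical
  simp [tripleWeight, ← Fintype.prod_sum, hP]

theorem sum_tripleWeight_mul (hP : ∀ s, ∑ i, P s i = 1) (s : Fin 3) (h : α → ℝ) :
    ∑ ω, tripleWeight P ω * h (ω s) = ∑ i, P s i * h i := by
  classical
  have h1 : ∀ ω : Fin 3 → α, tripleWeight P ω * h (ω s)
      = ∏ s', P s' (ω s') * (if s' = s then h (ω s') else 1) := by
    intro ω
    rw [Finset.prod_mul_distrib, Finset.prod_ite_eq']
    simp [tripleWeight]
  simp only [h1]
  rw [← Fintype.prod_sum (fun s' i => P s' i * (if s' = s then h i else 1)),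
    ← Finset.mul_prod_erase _ _ (Finset.mem_univ s)]
  rw [Finset.prod_eq_one]
  · simp
  · intro t ht
    simp [Finset.ne_of_mem_erase ht, hP]

variable {a : α → ℝ} {γ δ : Fin 3 → ℝ}

/-- The linear term of the variance. -/
theorem kern_lin_le (hP0 : ∀ s i, 0 ≤ P s i) (hP : ∀ s, ∑ i, P s i = 1) (ha0 : ∀ i, 0 ≤ a i)
    (ha1 : ∀ i, a i ≤ 1) (hγ : ∀ s, |γ s| ≤ 1) {r : ℝ} (hr0 : 0 ≤ r)
    (hr : ∑ i, a i * ∑ s, P s i ^ 2 ≤ r ^ 2) :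
    ∑ ω, tripleWeight P ω * (∑ s, γ s * (a (ω s) * comb P δ (ω s))) ^ 2
      ≤ 9 * r * combInner a P δ δ := by
  -- As a ≤ 1, the square of a i * P s i is at most a single term of the sum bounded by r².
  have hPr : ∀ s i, a i * P s i ≤ r := by
    intro s i
    refine abs_le_of_sq_le_sq' ?_ hr0 |>.2
    calc (a i * P s i) ^ 2 ≤ a i * P s i ^ 2 := by
          rw [mul_pow]
          nlinarith [mul_nonneg (mul_nonneg (ha0 i) (sub_nonneg.2 (ha1 i))) (sq_nonneg (P s i))]
      _ ≤ a i * ∑ s, P s i ^ 2 := mul_le_mul_of_nonneg_left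
          (Finset.single_le_sum (f := fun s => P s i ^ 2) (fun _ _ => sq_nonneg _)
            (Finset.mem_univ s)) (ha0 i)
      _ ≤ ∑ i, a i * ∑ s, P s i ^ 2 := Finset.single_le_sum
          (f := fun i => a i * ∑ s, P s i ^ 2)
          (fun i _ => mul_nonneg (ha0 i) (Finset.sum_nonneg fun _ _ => sq_nonneg _))
          (Finset.mem_univ i)
      _ ≤ r ^ 2 := hr
  calc _ ≤ ∑ ω, tripleWeight P ω * ∑ s, 3 * (a (ω s) * comb P δ (ω s)) ^ 2 := by
        gcongr with ω
        · exact tripleWeight_nonneg hP0 ω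
        have := sq_sum_le_card_mul_sum_sq (s := (Finset.univ : Finset (Fin 3)))
            (f := fun s => γ s * (a (ω s) * comb P δ (ω s)))
        simp only [Finset.card_univ, Fintype.card_fin, Nat.cast_ofNat] at this
        refine this.trans ?_
        rw [Finset.mul_sum]
        refine Finset.sum_le_sum fun s _ => mul_le_mul_of_nonneg_left ?_ (by norm_num)
        rw [mul_pow]
        exact mul_le_of_le_one_left (sq_nonneg _) ((sq_le_one_iff_abs_le_one _).2 (hγ s))
    _ = ∑ s, ∑ ω, tripleWeight P ω * (3 * (a (ω s) * comb P δ (ω s)) ^ 2) := by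
        simp only [Finset.mul_sum]
        rw [Finset.sum_comm]
    _ = ∑ s, ∑ i, P s i * (3 * (a i * comb P δ i) ^ 2) :=
        Finset.sum_congr rfl fun s _ =>
          sum_tripleWeight_mul hP s (fun i => 3 * (a i * comb P δ i) ^ 2)
    _ ≤ ∑ s : Fin 3, ∑ i, 3 * r * (a i * (comb P δ i * comb P δ i)) := by
        refine Finset.sum_le_sum fun s _ => Finset.sum_le_sum fun i _ => ?_
        nlinarith [mul_le_mul_of_nonneg_right (hPr s i)
          (mul_nonneg (ha0 i) (sq_nonneg (comb P δ i)))]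
    _ = _ := by
        rw [combInner, ← Finset.mul_sum]
        simp; ring

variable [DecidableEq α]

theorem sum_kern_right (hP : ∀ s, ∑ i, P s i = 1) (ω : Fin 3 → α) :
    ∑ ω', tripleWeight P ω' * kern a γ δ ω ω' = ∑ s, γ s * (a (ω s) * comb P δ (ω s)) := by
  simp only [kern, Finset.mul_sum]
  rw [Finset.sum_comm]
  refine Finset.sum_congr rfl fun s _ => ?_
  rw [Finset.sum_comm]
  simp only [comb, Finset.mul_sum]
  refine Finset.sum_congr rfl fun t _ => ?_
  rw [sum_tripleWeight_mul hP t (fun i => γ s * δ t * if ω s = i then a (ω s) else 0)]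
  simp
  ring

theorem sum_kern_left (hP : ∀ s, ∑ i, P s i = 1) (ω' : Fin 3 → α) :
    ∑ ω, tripleWeight P ω * kern a γ δ ω ω' = ∑ s, δ s * (a (ω' s) * comb P γ (ω' s)) := by
  simp only [kern_symm (γ := γ)]
  exact sum_kern_right hP ω'

theorem sum_sum_kern (hP : ∀ s, ∑ i, P s i = 1) :
    ∑ ω, tripleWeight P ω * ∑ ω', tripleWeight P ω' * kern a γ δ ω ω' = combInner a P γ δ := by
  simp only [sum_kern_right hP, Finset.mul_sum]
  rw [Finset.sum_comm]
  have : ∀ s, ∑ ω, tripleWeight P ω * (γ s * (a (ω s) * comb P δ (ω s)))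
      = ∑ i, P s i * (γ s * (a i * comb P δ i)) := fun s =>
    sum_tripleWeight_mul hP s (fun i => γ s * (a i * comb P δ i))
  simp only [this, combInner]
  rw [Finset.sum_comm]
  refine Finset.sum_congr rfl fun i _ => ?_
  rw [comb.eq_def P γ, Finset.sum_mul, Finset.mul_sum]
  exact Finset.sum_congr rfl fun s _ => by ring

/-- The diagonal term of the variance. -/
theorem kern_sq_le (hP0 : ∀ s i, 0 ≤ P s i) (hP : ∀ s, ∑ i, P s i = 1) (ha0 : ∀ i, 0 ≤ a i)
    (ha1 : ∀ i, a i ≤ 1) (hγ : ∀ s, |γ s| ≤ 1) (hδ : ∀ s, |δ s| ≤ 1) {r : ℝ}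
    (hr : ∑ i, a i * ∑ s, P s i ^ 2 ≤ r ^ 2) :
    ∑ ω, tripleWeight P ω * ∑ ω', tripleWeight P ω' * kern a γ δ ω ω' ^ 2 ≤ 27 * r ^ 2 := by
  -- Cauchy–Schwarz over the nine pairs (s, t) costs 9; bounding (∑ₜ P t i)² later costs 3 more,
  -- hence 27.
  have h1 : ∀ ω ω' : Fin 3 → α, kern a γ δ ω ω' ^ 2
      ≤ ∑ s, ∑ t, 9 * (if ω s = ω' t then a (ω s) else 0) := by
    intro ω ω'
    have hb : ∀ s t, (γ s * δ t * (if ω s = ω' t then a (ω s) else 0)) ^ 2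
        ≤ (if ω s = ω' t then a (ω s) else 0) := by
      intro s t
      have h2 : (γ s * δ t) ^ 2 ≤ 1 := by
        rw [sq_le_one_iff_abs_le_one, abs_mul]
        exact mul_le_one₀ (hγ s) (abs_nonneg _) (hδ t)
      split_ifs
      · rw [mul_pow]
        have := ha0 (ω s); have := ha1 (ω s)
        nlinarith [sq_nonneg (γ s * δ t), mul_nonneg (ha0 (ω s)) (sub_nonneg.2 (ha1 (ω s)))]
      · simp
    calc kern a γ δ ω ω' ^ 2
        ≤ 3 * ∑ s, (∑ t, γ s * δ t * (if ω s = ω' t then a (ω s) else 0)) ^ 2 := by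
          have := sq_sum_le_card_mul_sum_sq (s := (Finset.univ : Finset (Fin 3)))
            (f := fun s => ∑ t, γ s * δ t * (if ω s = ω' t then a (ω s) else 0))
          simpa [kern] using this
      _ ≤ 3 * ∑ s, (3 * ∑ t, (γ s * δ t * (if ω s = ω' t then a (ω s) else 0)) ^ 2) := by
          gcongr with s
          have := sq_sum_le_card_mul_sum_sq (s := (Finset.univ : Finset (Fin 3)))
            (f := fun t => γ s * δ t * (if ω s = ω' t then a (ω s) else 0))
          simpa using this
      _ ≤ 3 * ∑ s, (3 * ∑ t, (if ω s = ω' t then a (ω s) else 0)) := by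
          gcongr with s _ t; exact hb s t
      _ = _ := by
          simp only [Finset.mul_sum]
          exact Finset.sum_congr rfl fun s _ => Finset.sum_congr rfl fun t _ => by ring
  have h2 : ∀ ω : Fin 3 → α, ∑ ω', tripleWeight P ω' * kern a γ δ ω ω' ^ 2
      ≤ ∑ s, 9 * (a (ω s) * ∑ t, P t (ω s)) := by
    intro ω
    calc _ ≤ ∑ ω', tripleWeight P ω' * ∑ s, ∑ t, 9 * (if ω s = ω' t then a (ω s) else 0) := by
          gcongr with ω'
          · exact tripleWeight_nonneg hP0 ω'
          · exact h1 ω ω'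
      _ = ∑ s, ∑ t, ∑ ω', tripleWeight P ω' * (9 * (if ω s = ω' t then a (ω s) else 0)) := by
          simp only [Finset.mul_sum]
          rw [Finset.sum_comm]
          exact Finset.sum_congr rfl fun s _ => Finset.sum_comm
      _ = _ := by
          refine Finset.sum_congr rfl fun s _ => ?_
          rw [Finset.mul_sum, Finset.mul_sum]
          refine Finset.sum_congr rfl fun t _ => ?_
          rw [sum_tripleWeight_mul hP t (fun i => 9 * if ω s = i then a (ω s) else 0)]
          simp; ring
  calc _ ≤ ∑ ω, tripleWeight P ω * ∑ s, 9 * (a (ω s) * ∑ t, P t (ω s)) := by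
        gcongr with ω
        · exact tripleWeight_nonneg hP0 ω
        · exact h2 ω
    _ = ∑ s, ∑ ω, tripleWeight P ω * (9 * (a (ω s) * ∑ t, P t (ω s))) := by
        simp only [Finset.mul_sum (s := (Finset.univ : Finset (Fin 3)))]
        rw [Finset.sum_comm]
    _ = ∑ s, ∑ i, P s i * (9 * (a i * ∑ t, P t i)) :=
        Finset.sum_congr rfl fun s _ =>
          sum_tripleWeight_mul hP s (fun i => 9 * (a i * ∑ t, P t i))
    _ = ∑ i, 9 * (a i * (∑ t, P t i) ^ 2) := by
        rw [Finset.sum_comm]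
        refine Finset.sum_congr rfl fun i _ => ?_
        rw [← Finset.sum_mul]; ring
    _ ≤ ∑ i, 27 * (a i * ∑ t, P t i ^ 2) := by
        refine Finset.sum_le_sum fun i _ => ?_
        have := sq_sum_le_card_mul_sum_sq (s := (Finset.univ : Finset (Fin 3)))
            (f := fun t => P t i)
        simp only [Finset.card_univ, Fintype.card_fin, Nat.cast_ofNat] at this
        nlinarith [mul_le_mul_of_nonneg_left this (ha0 i)]
    _ ≤ 27 * r ^ 2 := by rw [← Finset.mul_sum]; linarith

/-- Independence of the two batches removes diagonal terms, so `stat` is unbiased. The second term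
of the bound is proportional to the quantities being estimated, which later allows errors to be
measured relative to the distance itself. -/
theorem stat_variance (hP0 : ∀ s i, 0 ≤ P s i) (hP : ∀ s, ∑ i, P s i = 1) (ha0 : ∀ i, 0 ≤ a i)
    (ha1 : ∀ i, a i ≤ 1) (hγ : ∀ s, |γ s| ≤ 1) (hδ : ∀ s, |δ s| ≤ 1) {r : ℝ} (hr0 : 0 ≤ r)
    (hr : ∑ i, a i * ∑ s, P s i ^ 2 ≤ r ^ 2) {m : ℕ} (hm : 1 ≤ m) :
    ∑ C : Fin m → Fin 3 → α, (∏ j, tripleWeight P (C j)) * ∑ B : Fin m → Fin 3 → α,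
        (∏ j, tripleWeight P (B j)) * (stat a γ δ B C - combInner a P γ δ) ^ 2
      ≤ 27 * (r / m) ^ 2 + 9 * (r / m) * (combInner a P γ γ + combInner a P δ δ) := by
  have hm0 : (0 : ℝ) < m := by exact_mod_cast hm
  have h := bilinear_variance (tripleWeight_nonneg hP0) (sum_tripleWeight hP) (kern a γ δ) hm
  simp only [sum_sum_kern hP] at h
  have h1 : ∀ B C : Fin m → Fin 3 → α, (stat a γ δ B C - combInner a P γ δ) ^ 2
      = (1 / m ^ 4) * ((∑ j, ∑ k, kern a γ δ (B j) (C k)) - m ^ 2 * combInner a P γ δ) ^ 2 := by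
    intro B C
    rw [stat]; field_simp
  have h2 : ∑ C : Fin m → Fin 3 → α, (∏ j, tripleWeight P (C j)) * ∑ B : Fin m → Fin 3 → α,
        (∏ j, tripleWeight P (B j)) * (stat a γ δ B C - combInner a P γ δ) ^ 2
      = (1 / m ^ 4) * ∑ C : Fin m → Fin 3 → α, (∏ j, tripleWeight P (C j)) *
        ∑ B : Fin m → Fin 3 → α, (∏ j, tripleWeight P (B j)) *
        ((∑ j, ∑ k, kern a γ δ (B j) (C k)) - m ^ 2 * combInner a P γ δ) ^ 2 := by
    rw [Finset.mul_sum]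
    refine Finset.sum_congr rfl fun C _ => ?_
    rw [mul_left_comm, Finset.mul_sum (a := 1 / (m : ℝ) ^ 4)]
    congr 1
    refine Finset.sum_congr rfl fun B _ => ?_
    rw [h1]; ring
  rw [h2]
  have h3 := kern_sq_le hP0 hP ha0 ha1 hγ hδ hr
  have h4 := kern_lin_le (δ := δ) hP0 hP ha0 ha1 hγ hr0 hr
  have h5 := kern_lin_le (δ := γ) hP0 hP ha0 ha1 hδ hr0 hr
  simp only [sum_kern_right hP, sum_kern_left hP] at h
  calc _ ≤ (1 / (m : ℝ) ^ 4) * (m ^ 2 * (27 * r ^ 2) + m ^ 3 *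
        (9 * r * combInner a P δ δ + 9 * r * combInner a P γ γ)) := by
        gcongr
        refine h.trans ?_
        gcongr
    _ = _ := by field_simp; ring

end

/-! ### The segment of mixtures -/

/-- The coefficients of `p - ((1 - α) q₁ + α q₂)`. -/
def mixVec (α : ℝ) : Fin 3 → ℝ := ![1, -(1 - α), -α]

/-- The coefficients of `q₂ - q₁`. -/
def dirVec : Fin 3 → ℝ := ![0, -1, 1]

/-- This makes both the true squared distance and its estimate quadratic polynomials in the
displacement t. -/
theorem mixVec_add (α t : ℝ) : mixVec (α + t) = fun s => mixVec α s - t * dirVec s := by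
  ext s
  fin_cases s <;> simp [mixVec, dirVec] <;> ring

theorem abs_mixVec_le {α : ℝ} (h0 : 0 ≤ α) (h1 : α ≤ 1) (s : Fin 3) : |mixVec α s| ≤ 1 := by
  fin_cases s <;> simp [mixVec, abs_le] <;> constructor <;> linarith

theorem abs_dirVec_le (s : Fin 3) : |dirVec s| ≤ 1 := by
  fin_cases s <;> simp [dirVec]

section
variable {α : Type*} [Fintype α] {a : α → ℝ} {P : Fin 3 → α → ℝ}

theorem combInner_expand (γ δ : Fin 3 → ℝ) (t : ℝ) :
    combInner a P (fun s => γ s - t * δ s) (fun s => γ s - t * δ s)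
      = combInner a P γ γ - t * (combInner a P γ δ + combInner a P δ γ)
        + t ^ 2 * combInner a P δ δ := by
  have h : ∀ i, comb P (fun s => γ s - t * δ s) i = comb P γ i - t * comb P δ i := by
    intro i
    simp only [comb, Finset.mul_sum, ← Finset.sum_sub_distrib]
    exact Finset.sum_congr rfl fun s _ => by ring
  simp only [combInner, h, Finset.mul_sum, ← Finset.sum_add_distrib, ← Finset.sum_sub_distrib]
  exact Finset.sum_congr rfl fun s _ => by ring

theorem combInner_self_nonneg (ha0 : ∀ i, 0 ≤ a i) (γ : Fin 3 → ℝ) : 0 ≤ combInner a P γ γ :=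
  Finset.sum_nonneg fun i _ => mul_nonneg (ha0 i) (mul_self_nonneg _)

/-- The closest point of the segment, with the resulting quadratic growth. -/
theorem exists_closest_mixture (ha0 : ∀ i, 0 ≤ a i) :
    ∃ x : ℝ, 0 ≤ x ∧ x ≤ 1 ∧ ∀ y, 0 ≤ y → y ≤ 1 →
      combInner a P (mixVec x) (mixVec x) + (y - x) ^ 2 * combInner a P dirVec dirVec
        ≤ combInner a P (mixVec y) (mixVec y) := by
  have hexp : ∀ x y, combInner a P (mixVec y) (mixVec y) = combInner a P (mixVec x) (mixVec x)
      - (y - x) * (combInner a P (mixVec x) dirVec + combInner a P dirVec (mixVec x))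
      + (y - x) ^ 2 * combInner a P dirVec dirVec := by
    intro x y
    rw [← combInner_expand, ← mixVec_add]; simp
  have hcont : Continuous fun y => combInner a P (mixVec y) (mixVec y) := 
    (continuous_congr (hexp 0)).2 (by fun_prop)
  obtain ⟨x, ⟨hx0, hx1⟩, hmin⟩ := isCompact_Icc.exists_isMinOn (s := Set.Icc (0 : ℝ) 1)
    (Set.nonempty_Icc.2 zero_le_one) hcont.continuousOn
  refine ⟨x, hx0, hx1, fun y hy0 hy1 => ?_⟩
  rw [hexp x y]
  set L := combInner a P (mixVec x) dirVec + combInner a P dirVec (mixVec x)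
  set U := combInner a P dirVec dirVec with hU
  have hU0 : 0 ≤ U := combInner_self_nonneg ha0 _
  -- The first-order condition at the minimiser x: moving towards y does not decrease the quadratic
  -- to first order.
  suffices h : (y - x) * L ≤ 0 by linarith
  by_contra! hL
  set d := (y - x) * L
  set e := (y - x) ^ 2 * U
  have he : 0 ≤ e := by positivity
  have hs : ∀ s : ℝ, 0 ≤ s → s ≤ 1 → 0 ≤ - (s * d) + s ^ 2 * e := by
    intro s hs0 hs1
    have hmem : x + s * (y - x) ∈ Set.Icc (0 : ℝ) 1 := by
      constructor <;> nlinarith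
    have h := isMinOn_iff.1 hmin _ hmem
    rw [hexp x (x + s * (y - x))] at h
    simp only [d, e]
    simp only [add_sub_cancel_left] at h
    nlinarith
  -- For d > 0 this step s is at most 1 and satisfies s e < d, so -s d + s² e would be negative.
  have h := hs (d / (d + e + d)) (by positivity) (by rw [div_le_one (by positivity)]; linarith)
  set s := d / (d + e + d) with hsdef
  have hs0 : 0 < s := by positivity
  have h2 : s * (d + e + d) = d := by rw [hsdef]; field_simp
  have h3 : 0 ≤ -d + s * e := by
    refine nonneg_of_mul_nonneg_right ?_ hs0
    linarith
  nlinarith [mul_pos hs0 hL]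

/-- The expectation of a function of two batches of sample triples. -/
noncomputable def expect₂ {m : ℕ} (P : Fin 3 → α → ℝ)
    (F : (Fin m → Fin 3 → α) → (Fin m → Fin 3 → α) → ℝ) : ℝ :=
  ∑ C : Fin m → Fin 3 → α, (∏ j, tripleWeight P (C j)) * ∑ B : Fin m → Fin 3 → α,
    (∏ j, tripleWeight P (B j)) * F B C

theorem expect₂_mono {m : ℕ} (hP0 : ∀ s i, 0 ≤ P s i)
    {F G : (Fin m → Fin 3 → α) → (Fin m → Fin 3 → α) → ℝ} (h : ∀ B C, F B C ≤ G B C) :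
    expect₂ P F ≤ expect₂ P G := by
  refine Finset.sum_le_sum fun C _ => mul_le_mul_of_nonneg_left
    (Finset.sum_le_sum fun B _ => mul_le_mul_of_nonneg_left (h B C) ?_) ?_ <;>
  exact Finset.prod_nonneg fun j _ => tripleWeight_nonneg hP0 _

theorem expect₂_add {m : ℕ} (F G : (Fin m → Fin 3 → α) → (Fin m → Fin 3 → α) → ℝ) :
    expect₂ P (fun B C => F B C + G B C) = expect₂ P F + expect₂ P G := by
  simp only [expect₂, mul_add, Finset.sum_add_distrib]

theorem expect₂_div {m : ℕ} (F : (Fin m → Fin 3 → α) → (Fin m → Fin 3 → α) → ℝ) (c : ℝ) :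
    expect₂ P (fun B C => F B C / c) = expect₂ P F / c := by
  simp only [expect₂, Finset.sum_div, mul_div_assoc]

theorem expect₂_one_sub {m : ℕ} (hP : ∀ s, ∑ i, P s i = 1)
    (F : (Fin m → Fin 3 → α) → (Fin m → Fin 3 → α) → ℝ) :
    expect₂ P (fun B C => 1 - F B C) = 1 - expect₂ P F := by
  simp only [expect₂, mul_sub, Finset.sum_sub_distrib, mul_one,
    sum_prod_weight (sum_tripleWeight hP)]

end

/-! ### Error probabilities of the acceptance criterion -/

/-- Here s is a power of the displacement along the segment and Z a sum of two squared norms; Z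
alone may far exceed Q, but s² Z does not. The main term is 20 · 9 · 2 / 40000 = 9/1000 of Q², just
below the required 1/100; this fixes the constant 40000. -/
theorem scaled_deviation_le {κ Q s D Z : ℝ} (hκ0 : 0 ≤ κ) (hκ : κ ≤ Q / 40000) (hs : s ^ 2 ≤ 1)
    (hZ : s ^ 2 * Z ≤ 2 * Q) (hD : D ^ 2 ≤ 20 * (27 * κ ^ 2 + 9 * κ * Z)) : |s * D| ≤ Q / 10 := by
  refine abs_le_of_sq_le_sq ?_ (by linarith)
  have h1 : (s * D) ^ 2 ≤ s ^ 2 * (20 * (27 * κ ^ 2 + 9 * κ * Z)) := by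
    rw [mul_pow]; exact mul_le_mul_of_nonneg_left hD (sq_nonneg _)
  have h2 : s ^ 2 * κ ^ 2 ≤ κ * (Q / 40000) := by
    nlinarith [mul_le_mul_of_nonneg_right hs (sq_nonneg κ), mul_le_mul_of_nonneg_left hκ hκ0]
  have h3 : κ * (s ^ 2 * Z) ≤ κ * (2 * Q) := mul_le_mul_of_nonneg_left hZ hκ0
  have h4 : κ * Q ≤ Q / 40000 * Q := mul_le_mul_of_nonneg_right hκ (by linarith)
  have h5 : 0 ≤ κ * Q := mul_nonneg hκ0 (by linarith)
  nlinarith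

section
variable {α : Type*} [DecidableEq α] {a : α → ℝ}

theorem kern_expand (γ δ : Fin 3 → ℝ) (t : ℝ) (ω ω' : Fin 3 → α) :
    kern a (fun s => γ s - t * δ s) (fun s => γ s - t * δ s) ω ω'
      = kern a γ γ ω ω' - t * (kern a γ δ ω ω' + kern a δ γ ω ω') + t ^ 2 * kern a δ δ ω ω' := by
  simp only [kern, Finset.mul_sum, ← Finset.sum_add_distrib, ← Finset.sum_sub_distrib]
  exact Finset.sum_congr rfl fun s _ => Finset.sum_congr rfl fun t _ => by ring

theorem stat_expand {m : ℕ} (γ δ : Fin 3 → ℝ) (t : ℝ) (B C : Fin m → Fin 3 → α) :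
    stat a (fun s => γ s - t * δ s) (fun s => γ s - t * δ s) B C
      = stat a γ γ B C - t * (stat a γ δ B C + stat a δ γ B C) + t ^ 2 * stat a δ δ B C := by
  simp only [stat, kern_expand, Finset.sum_add_distrib, Finset.sum_sub_distrib, ← Finset.mul_sum]
  ring

/-- The acceptance criterion of the tester. -/
def Accepts {m : ℕ} (a : α → ℝ) (h : ℝ) (B C : Fin m → Fin 3 → α) : Prop :=
  ∃ x : ℝ, 0 ≤ x ∧ x ≤ 1 ∧ stat a (mixVec x) (mixVec x) B C ≤ h / 2

variable [Fintype α] {P : Fin 3 → α → ℝ}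

open Classical in
/-- The failure probability of the tester on a mixture. -/
theorem reject_prob_le (hP0 : ∀ s i, 0 ≤ P s i) (hP : ∀ s, ∑ i, P s i = 1) (ha0 : ∀ i, 0 ≤ a i)
    (ha1 : ∀ i, a i ≤ 1) {r h : ℝ} (hr0 : 0 ≤ r) (hr : ∑ i, a i * ∑ s, P s i ^ 2 ≤ r ^ 2) {m : ℕ}
    (hm : 1 ≤ m) (hh : 0 < h) (hκ : r / m ≤ h / 40000) {x : ℝ} (hx0 : 0 ≤ x) (hx1 : x ≤ 1)
    (hx : ∀ i, comb P (mixVec x) i = 0) :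
    expect₂ (m := m) P (fun B C => if Accepts a h B C then 0 else 1) ≤ 1 / 5 := by
  have hv := stat_variance hP0 hP ha0 ha1 (abs_mixVec_le hx0 hx1) (abs_mixVec_le hx0 hx1) hr0 hr hm
  -- At the true mixing weight the signal vanishes and only 27 (r / m)² remains of the variance.
  have hz : combInner a P (mixVec x) (mixVec x) = 0 := by simp [combInner, hx]
  rw [hz] at hv
  have h1 : expect₂ (m := m) P (fun B C => if Accepts a h B C then 0 else 1)
      ≤ expect₂ (m := m) P
        (fun B C => (stat a (mixVec x) (mixVec x) B C - 0) ^ 2 / (h / 2) ^ 2) := by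
    refine expect₂_mono hP0 fun B C => ?_
    split_ifs with hacc
    · positivity
    · have : h / 2 < stat a (mixVec x) (mixVec x) B C := by
        by_contra! hcon
        exact hacc ⟨x, hx0, hx1, hcon⟩
      rw [one_le_div (by positivity), sub_zero]
      gcongr
  refine h1.trans ?_
  rw [expect₂_div, div_le_iff₀ (by positivity)]
  refine hv.trans ?_
  have hκ0 : 0 ≤ r / m := by positivity
  have := mul_le_mul hκ hκ hκ0 (by positivity)
  nlinarith [sq_nonneg h]

open Classical in
/-- The failure probability of the tester far from all mixtures. -/
theorem accept_prob_le (hP0 : ∀ s i, 0 ≤ P s i) (hP : ∀ s, ∑ i, P s i = 1) (ha0 : ∀ i, 0 ≤ a i)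
    (ha1 : ∀ i, a i ≤ 1) {r h : ℝ} (hr0 : 0 < r) (hr : ∑ i, a i * ∑ s, P s i ^ 2 ≤ r ^ 2) {m : ℕ}
    (hm : 1 ≤ m) (hκ : r / m ≤ h / 40000)
    (hfar : ∀ x : ℝ, 0 ≤ x → x ≤ 1 → h ≤ combInner a P (mixVec x) (mixVec x)) :
    expect₂ (m := m) P (fun B C => if Accepts a h B C then 1 else 0) ≤ 1 / 5 := by
  obtain ⟨x, hx0, hx1, hx⟩ := exists_closest_mixture (P := P) ha0
  have hm0 : (0 : ℝ) < m := by exact_mod_cast hm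
  set κ := r / m with hκdef
  have hκ0 : 0 < κ := by positivity
  set w := mixVec x with hw
  have hw1 : ∀ s, |w s| ≤ 1 := abs_mixVec_le hx0 hx1
  have hW := hfar x hx0 hx1
  have hU : 0 ≤ combInner a P dirVec dirVec := combInner_self_nonneg ha0 _
  set W := combInner a P w w
  set U := combInner a P dirVec dirVec
  -- Twenty times the variance bound: each of the four estimates leaves its range with probability
  -- at most 1/20, in total 1/5.
  set V : (Fin 3 → ℝ) → (Fin 3 → ℝ) → ℝ := fun γ δ =>
    20 * (27 * κ ^ 2 + 9 * κ * (combInner a P γ γ + combInner a P δ δ)) with hV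
  have hVpos : ∀ γ δ, 0 < V γ δ := by
    intro γ δ
    have := combInner_self_nonneg (P := P) ha0 γ
    have := combInner_self_nonneg (P := P) ha0 δ
    simp only [hV]; positivity
  set D : (Fin 3 → ℝ) → (Fin 3 → ℝ) → (Fin m → Fin 3 → α) → (Fin m → Fin 3 → α) → ℝ :=
    fun γ δ B C => (stat a γ δ B C - combInner a P γ δ) ^ 2 / V γ δ with hD
  have hcheb : ∀ γ δ, (∀ s, |γ s| ≤ 1) → (∀ s, |δ s| ≤ 1) → expect₂ P (D γ δ) ≤ 1 / 20 := by
    intro γ δ hγ hδ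
    have hv := stat_variance hP0 hP ha0 ha1 hγ hδ hr0.le hr hm
    simp only [hD]
    rw [expect₂_div, div_le_iff₀ (hVpos γ δ)]
    refine hv.trans (le_of_eq ?_)
    simp only [hV]; ring
  have hDnn : ∀ γ δ B C, 0 ≤ D γ δ B C := fun γ δ B C => div_nonneg (sq_nonneg _) (hVpos γ δ).le
  have h1 : expect₂ (m := m) P (fun B C => if Accepts a h B C then 1 else 0)
      ≤ expect₂ (m := m) P (fun B C => ((D w w B C + D w dirVec B C) + D dirVec w B C)
        + D dirVec dirVec B C) := by
    refine expect₂_mono hP0 fun B C => ?_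
    have n1 := hDnn w w B C
    have n2 := hDnn w dirVec B C
    have n3 := hDnn dirVec w B C
    have n4 := hDnn dirVec dirVec B C
    split_ifs with hacc
    swap
    · positivity
    by_contra! hlt
    obtain ⟨y, hy0, hy1, hy⟩ := hacc
    obtain ⟨t, rfl⟩ : ∃ t, y = x + t := ⟨y - x, by ring⟩
    have hq := hx (x + t) hy0 hy1
    rw [mixVec_add, ← hw, stat_expand] at hy
    rw [mixVec_add, ← hw, combInner_expand, add_sub_cancel_left] at hq
    have ht : t ^ 2 ≤ 1 := by
      rw [sq_le_one_iff_abs_le_one, abs_le]; constructor <;> linarith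
    have hdev : ∀ γ δ, D γ δ B C < 1 → (stat a γ δ B C - combInner a P γ δ) ^ 2 ≤ V γ δ := by
      intro γ δ hlt
      exact ((div_lt_one (hVpos γ δ)).1 hlt).le
    -- Quadratic growth bounds the true squared distance at x + t below by Q ≥ h. The four scaled
    -- deviations are at most Q/10 each, so the estimate is at least 6Q/10 > h/2.
    set Q := W + t ^ 2 * U with hQ
    have htU : 0 ≤ t ^ 2 * U := by positivity
    have hκQ : κ ≤ Q / 40000 := by linarith
    have hW0 : 0 < W := by linarith
    have htW : t ^ 2 * W ≤ W := mul_le_of_le_one_left hW0.le ht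
    have ht4 : (t ^ 2) ^ 2 ≤ t ^ 2 := by nlinarith [sq_nonneg t]
    have htU4 : (t ^ 2) ^ 2 * U ≤ t ^ 2 * U := mul_le_mul_of_nonneg_right ht4 hU
    have e1 := scaled_deviation_le (s := 1) hκ0.le hκQ (by norm_num)
      (by linarith : (1 : ℝ) ^ 2 * (W + W) ≤ 2 * Q) (hdev w w (by linarith))
    have e2 := scaled_deviation_le (s := t) hκ0.le hκQ ht
      (by linarith : t ^ 2 * (W + U) ≤ 2 * Q) (hdev w dirVec (by linarith))
    have e3 := scaled_deviation_le (s := t) hκ0.le hκQ ht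
      (by linarith : t ^ 2 * (U + W) ≤ 2 * Q) (hdev dirVec w (by linarith))
    have e4 := scaled_deviation_le (s := t ^ 2) hκ0.le hκQ (by linarith)
      (by linarith : (t ^ 2) ^ 2 * (U + U) ≤ 2 * Q) (hdev dirVec dirVec (by linarith))
    rw [abs_le] at e1 e2 e3 e4
    linarith [e1.1, e2.2, e3.2, e4.1]
  refine h1.trans ?_
  rw [expect₂_add, expect₂_add, expect₂_add]
  have c1 := hcheb w w hw1 hw1
  have c2 := hcheb w dirVec hw1 abs_dirVec_le
  have c3 := hcheb dirVec w abs_dirVec_le hw1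
  have c4 := hcheb dirVec dirVec abs_dirVec_le abs_dirVec_le
  linarith

end

/-! ### Flattening by random buckets -/

/-- The number of buckets that the sample triples `A` assign to each element. -/
def buckets {n k : ℕ} (A : Fin k → Fin 3 → Fin n) (i : Fin n) : ℝ :=
  1 + ∑ j, ∑ s, if A j s = i then (1 : ℝ) else 0

theorem one_le_buckets {n k : ℕ} (A : Fin k → Fin 3 → Fin n) (i : Fin n) : 1 ≤ buckets A i :=
  le_add_of_nonneg_right <| Finset.sum_nonneg fun _ _ => Finset.sum_nonneg fun _ _ => by
    split_ifs <;> norm_num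

theorem sum_buckets {n k : ℕ} (A : Fin k → Fin 3 → Fin n) :
    ∑ i, buckets A i = n + 3 * k := by
  simp only [buckets, Finset.sum_add_distrib]
  rw [Finset.sum_comm (s := (Finset.univ : Finset (Fin n)))]
  have : ∀ j, ∑ i, ∑ s, (if A j s = i then (1 : ℝ) else 0) = 3 := by
    intro j
    rw [Finset.sum_comm]; simp
  simp only [this, Finset.sum_const, Finset.card_univ, Fintype.card_fin, nsmul_eq_mul, mul_one]
  ring

/-- Splitting each element into its buckets makes all three distributions flat on average. -/
theorem expect_flattened_le {n k : ℕ} {P : Fin 3 → Fin n → ℝ} (hP0 : ∀ s i, 0 ≤ P s i)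
    (hP : ∀ s, ∑ i, P s i = 1) :
    ∑ A : Fin k → Fin 3 → Fin n, (∏ j, tripleWeight P (A j)) *
      ∑ i, (buckets A i)⁻¹ * ∑ s, P s i ^ 2 ≤ 3 / (k + 1) := by
  -- The samples from distribution s alone give the bound; those from the other two only add
  -- buckets.
  have h1 : ∀ s i, P s i * ∑ A : Fin k → Fin 3 → Fin n, (∏ j, tripleWeight P (A j)) *
      (buckets A i)⁻¹ ≤ 1 / (k + 1) := by
    intro s i
    have h := expect_inv_count_le (tripleWeight_nonneg hP0) (sum_tripleWeight hP)
      (fun ω => ω s = i) k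
    rw [sum_tripleWeight_mul hP s (fun i' => if i' = i then 1 else 0)] at h
    simp only [mul_ite, mul_one, mul_zero, Finset.sum_ite_eq', Finset.mem_univ, if_true] at h
    refine le_trans ?_ h
    refine mul_le_mul_of_nonneg_left (Finset.sum_le_sum fun A _ => ?_) (hP0 s i)
    refine mul_le_mul_of_nonneg_left ?_
      (Finset.prod_nonneg fun j _ => tripleWeight_nonneg hP0 _)
    refine inv_anti₀ (add_pos_of_pos_of_nonneg one_pos
      (Finset.sum_nonneg fun _ _ => by split_ifs <;> norm_num)) ?_
    rw [buckets]
    gcongr with j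
    exact Finset.single_le_sum (f := fun s => if A j s = i then (1 : ℝ) else 0)
      (fun _ _ => by split_ifs <;> norm_num) (Finset.mem_univ s)
  calc _ = ∑ s, ∑ i, P s i * (P s i * ∑ A : Fin k → Fin 3 → Fin n,
        (∏ j, tripleWeight P (A j)) * (buckets A i)⁻¹) := by
        simp only [Finset.mul_sum]
        rw [Finset.sum_comm, Finset.sum_comm (s := (Finset.univ : Finset (Fin 3)))]
        refine Finset.sum_congr rfl fun i _ => ?_
        rw [Finset.sum_comm]
        exact Finset.sum_congr rfl fun s _ => Finset.sum_congr rfl fun A _ => by ring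
    _ ≤ ∑ s, ∑ i, P s i * (1 / (k + 1)) := by
        gcongr with s _ i
        · exact hP0 s i
        · exact h1 s i
    _ = 3 / (k + 1) := by
        simp only [← Finset.sum_mul, hP]; simp; ring

/-! ### The tester and the upper bound -/

/-- Three sequences of samples form one sequence of sample triples. -/
def tripleEquiv (α : Type*) (m : ℕ) :
    (Fin m → α) × (Fin m → α) × (Fin m → α) ≃ (Fin m → Fin 3 → α) where
  toFun x j := ![x.1 j, x.2.1 j, x.2.2 j]
  invFun ω := (fun j => ω j 0, fun j => ω j 1, fun j => ω j 2)
  left_inv x := rfl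
  right_inv ω := by
    ext j s
    fin_cases s <;> rfl

/-- The algorithm that applies `G` to the sequence of sample triples. -/
def tripleAlgorithm {n m : ℕ} (G : (Fin m → Fin 3 → Fin n) → unitInterval) : Algorithm n m m m :=
  fun x y z => G (tripleEquiv (Fin n) m (x, y, z))

theorem acceptProb_tripleAlgorithm {n m : ℕ} (G : (Fin m → Fin 3 → Fin n) → unitInterval)
    (p q₁ q₂ : Dist n) : acceptProb (tripleAlgorithm G) p q₁ q₂
      = ∑ ω, (∏ j, tripleWeight ![p.1, q₁.1, q₂.1] (ω j)) * (G ω : ℝ) := by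
  rw [← (tripleEquiv (Fin n) m).sum_comp, Fintype.sum_prod_type]
  simp only [Fintype.sum_prod_type, acceptProb, tripleAlgorithm]
  refine Finset.sum_congr rfl fun x _ => Finset.sum_congr rfl fun y _ =>
    Finset.sum_congr rfl fun z _ => ?_
  congr 1
  simp only [sampleProb, ← Finset.prod_mul_distrib]
  refine Finset.prod_congr rfl fun j _ => ?_
  simp [tripleWeight, Fin.prod_univ_three]
  rfl

theorem sum_fin_add_fun {Ω : Type*} [Fintype Ω] {k l : ℕ} (f : (Fin (k + l) → Ω) → ℝ) :
    ∑ ω, f ω = ∑ A : Fin k → Ω, ∑ B : Fin l → Ω, f (Fin.append A B) := by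
  rw [← (Fin.appendEquiv k l).sum_comp, Fintype.sum_prod_type]
  rfl

open Classical in
/-- The tester: the first `k` sample triples determine the buckets, the remaining `2 m` triples
are used for the statistic. -/
noncomputable def mixtureTester (n k m : ℕ) (h : ℝ) :
    Algorithm n (k + (m + m)) (k + (m + m)) (k + (m + m)) :=
  tripleAlgorithm fun ω =>
    if Accepts (fun i => (buckets (fun j : Fin k => ω (Fin.castAdd (m + m) j)) i)⁻¹) h
      (fun j : Fin m => ω (Fin.natAdd k (Fin.natAdd m j)))
      (fun j : Fin m => ω (Fin.natAdd k (Fin.castAdd m j))) then 1 else 0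

open Classical in
theorem acceptProb_mixtureTester (n k m : ℕ) (h : ℝ) (p q₁ q₂ : Dist n) :
    acceptProb (mixtureTester n k m h) p q₁ q₂
      = ∑ A : Fin k → Fin 3 → Fin n, (∏ j, tripleWeight ![p.1, q₁.1, q₂.1] (A j)) *
        expect₂ (m := m) ![p.1, q₁.1, q₂.1]
          (fun B C => if Accepts (fun i => (buckets A i)⁻¹) h B C then 1 else 0) := by
  rw [mixtureTester, acceptProb_tripleAlgorithm, sum_fin_add_fun]
  refine Finset.sum_congr rfl fun A _ => ?_
  rw [sum_fin_add_fun, expect₂, Finset.mul_sum]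
  refine Finset.sum_congr rfl fun C _ => ?_
  rw [Finset.mul_sum, Finset.mul_sum]
  refine Finset.sum_congr rfl fun B _ => ?_
  simp only [Fin.prod_univ_add, Fin.append_left, Fin.append_right]
  rw [mul_assoc, mul_assoc]
  congr 3
  split_ifs <;> rfl

/-- The tester is correct as soon as the number of samples used for the statistic is large. -/
theorem isMixtureTester_mixtureTester {n k m : ℕ} {ε : ℝ} (hn : 1 ≤ n) (hε : 0 < ε) (hm : 1 ≤ m)
    (hκ : √(30 / (k + 1)) / m ≤ ε ^ 2 / (n + 3 * k) / 40000) :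
    IsMixtureTester ε (mixtureTester n k m (ε ^ 2 / (n + 3 * k))) := by
  classical
  intro p q₁ q₂
  set P : Fin 3 → Fin n → ℝ := ![p.1, q₁.1, q₂.1] with hPdef
  have hP0 : ∀ s i, 0 ≤ P s i := by
    intro s i
    fin_cases s
    exacts [p.2.1 i, q₁.2.1 i, q₂.2.1 i]
  have hP : ∀ s, ∑ i, P s i = 1 := by
    intro s
    fin_cases s
    exacts [p.2.2, q₁.2.2, q₂.2.2]
  have hn0 : (0 : ℝ) < n := by exact_mod_cast hn
  set h := ε ^ 2 / (n + 3 * k) with hh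
  have hh0 : 0 < h := by positivity
  have hcomb : ∀ x i, comb P (mixVec x) i = p.1 i - ((1 - x) * q₁.1 i + x * q₂.1 i) := by
    intro x i
    simp [comb, mixVec, hPdef, Fin.sum_univ_three]; ring
  have ha0 : ∀ (A : Fin k → Fin 3 → Fin n) i, 0 ≤ (buckets A i)⁻¹ := fun A i =>
    inv_nonneg.2 (zero_le_one.trans (one_le_buckets A i))
  have ha1 : ∀ (A : Fin k → Fin 3 → Fin n) i, (buckets A i)⁻¹ ≤ 1 := fun A i =>
    inv_le_one_of_one_le₀ (one_le_buckets A i)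
  have hr0 : 0 < √(30 / (k + 1) : ℝ) := by positivity
  have hw0 : ∀ A : Fin k → Fin 3 → Fin n, 0 ≤ ∏ j, tripleWeight P (A j) := fun A =>
    Finset.prod_nonneg fun j _ => tripleWeight_nonneg hP0 _
  have hone : expect₂ (m := m) P (fun _ _ => 1) = 1 := by
    simp [expect₂, sum_prod_weight (sum_tripleWeight hP)]
  have main : ∀ F : (Fin k → Fin 3 → Fin n) → (Fin m → Fin 3 → Fin n) →
      (Fin m → Fin 3 → Fin n) → ℝ, (∀ A B C, F A B C ≤ 1) →
      (∀ A, ∑ i, (buckets A i)⁻¹ * ∑ s, P s i ^ 2 ≤ √(30 / (k + 1) : ℝ) ^ 2 →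
        expect₂ P (F A) ≤ 1 / 5) →
      ∑ A : Fin k → Fin 3 → Fin n, (∏ j, tripleWeight P (A j)) * expect₂ P (F A) ≤ 1 / 3 := by
    intro F hF hgood
    -- Markov's inequality in additive form: where the flattened norm exceeds 30 / (k + 1) the last
    -- term is at least 1, and its mean is at most 1/10. The total error is 1/5 + 1/10 < 1/3.
    have hA : ∀ A, expect₂ P (F A)
        ≤ 1 / 5 + (∑ i, (buckets A i)⁻¹ * ∑ s, P s i ^ 2) * ((k + 1) / 30) := by
      intro A
      have hnn : 0 ≤ ∑ i, (buckets A i)⁻¹ * ∑ s, P s i ^ 2 := Finset.sum_nonneg fun i _ =>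
        mul_nonneg (ha0 A i) (Finset.sum_nonneg fun _ _ => sq_nonneg _)
      by_cases hb : ∑ i, (buckets A i)⁻¹ * ∑ s, P s i ^ 2 ≤ √(30 / (k + 1) : ℝ) ^ 2
      · have := hgood A hb
        have : 0 ≤ (∑ i, (buckets A i)⁻¹ * ∑ s, P s i ^ 2) * (((k : ℝ) + 1) / 30) := by positivity
        linarith
      · rw [Real.sq_sqrt (by positivity), not_le, div_lt_iff₀ (by positivity)] at hb
        have := expect₂_mono hP0 (hF A)
        rw [hone] at this
        linarith
    calc _ ≤ ∑ A : Fin k → Fin 3 → Fin n, ((∏ j, tripleWeight P (A j)) * (1 / 5)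
          + ((∏ j, tripleWeight P (A j)) * ∑ i, (buckets A i)⁻¹ * ∑ s, P s i ^ 2)
            * ((k + 1) / 30)) := by
          refine Finset.sum_le_sum fun A _ => ?_
          refine (mul_le_mul_of_nonneg_left (hA A) (hw0 A)).trans (le_of_eq (by ring))
      _ ≤ 1 / 5 + 3 / (k + 1) * ((k + 1) / 30) := by
          rw [Finset.sum_add_distrib, ← Finset.sum_mul, ← Finset.sum_mul,
            sum_prod_weight (sum_tripleWeight hP), one_mul]
          gcongr
          exact expect_flattened_le hP0 hP
      _ ≤ 1 / 3 := by
          have : (3 / (k + 1) * ((k + 1) / 30) : ℝ) = 1 / 10 := by field_simp; norm_num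
          rw [this]; norm_num
  have hacc := acceptProb_mixtureTester n k m h p q₁ q₂
  refine ⟨fun hmix => ?_, fun hfar => ?_⟩
  · obtain ⟨x, hx0, hx1, hx⟩ := hmix
    have h1 := main (fun A B C => if Accepts (fun i => (buckets A i)⁻¹) h B C then 0 else 1)
      (fun A B C => by split_ifs <;> norm_num) (fun A hA =>
        reject_prob_le hP0 hP (ha0 A) (ha1 A) hr0.le hA hm hh0 hκ hx0 hx1
          (fun i => by rw [hcomb, hx i, sub_self]))
    have h2 : ∀ A : Fin k → Fin 3 → Fin n, expect₂ (m := m) P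
        (fun B C => if Accepts (fun i => (buckets A i)⁻¹) h B C then 0 else 1)
        = 1 - expect₂ (m := m) P
          (fun B C => if Accepts (fun i => (buckets A i)⁻¹) h B C then 1 else 0) := by
      intro A
      rw [← expect₂_one_sub hP]
      congr 1
      ext B C
      split_ifs <;> norm_num
    simp only [h2, mul_sub, mul_one, Finset.sum_sub_distrib,
      sum_prod_weight (sum_tripleWeight hP)] at h1
    rw [hacc]
    linarith
  · have h1 := main (fun A B C => if Accepts (fun i => (buckets A i)⁻¹) h B C then 1 else 0)
      (fun A B C => by split_ifs <;> norm_num) (fun A hA =>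
        accept_prob_le hP0 hP (ha0 A) (ha1 A) hr0 hA hm hκ (fun x hx0 hx1 => ?_))
    · rw [hacc]
      linarith
    · have hmem : (fun i => (1 - x) * q₁.1 i + x * q₂.1 i) ∈ stdSimplex ℝ (Fin n) := by
        have := (convex_stdSimplex ℝ (Fin n)) q₁.2 q₂.2 (sub_nonneg.2 hx1) hx0 (by ring)
        convert this using 1
        ext i; simp
      have hd := hfar ⟨_, hmem⟩ ⟨x, hx0, hx1, fun i => rfl⟩
      -- Cauchy–Schwarz with weights bᵢ and 1/bᵢ, where ∑ bᵢ = n + 3k; this is where the threshold h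
      -- comes from.
      have hcs := Finset.sum_sq_le_sum_mul_sum_of_sq_le_mul Finset.univ
        (r := fun i => |comb P (mixVec x) i|)
        (f := fun i => buckets A i)
        (g := fun i => (buckets A i)⁻¹ * (comb P (mixVec x) i * comb P (mixVec x) i))
        (fun i _ => zero_le_one.trans (one_le_buckets A i))
        (fun i _ => mul_nonneg (ha0 A i) (mul_self_nonneg _))
        (fun i _ => le_of_eq <| by
          have : buckets A i ≠ 0 := (zero_lt_one.trans_le (one_le_buckets A i)).ne'
          rw [sq_abs]; field_simp)
      rw [sum_buckets] at hcs
      have hd' : ε ≤ ∑ i, |comb P (mixVec x) i| := by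
        simpa only [hcomb, l1Dist] using hd
      rw [hh, div_le_iff₀ (by positivity), mul_comm]
      exact (pow_le_pow_left₀ hε.le hd' 2).trans hcs

/-- Cubing clears the fractional exponents; all comparisons with this term go through its cube. -/
theorem two_thirds_term_pow_three (n : ℕ) {ε : ℝ} (hε : 0 < ε) :
    ((n : ℝ) ^ (2 / 3 : ℝ) / ε ^ (4 / 3 : ℝ)) ^ 3 = n ^ 2 / ε ^ 4 := by
  rw [div_pow, ← Real.rpow_natCast, ← Real.rpow_natCast, ← Real.rpow_mul (Nat.cast_nonneg n),
    ← Real.rpow_mul hε.le]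
  norm_num

theorem l1Dist_le_two {n : ℕ} (p q : Dist n) : l1Dist p q ≤ 2 := by
  calc l1Dist p q ≤ ∑ i, (p.1 i + q.1 i) := by
        refine Finset.sum_le_sum fun i _ => ?_
        have := p.2.1 i; have := q.2.1 i
        rw [abs_le]; constructor <;> linarith
    _ = 2 := by rw [Finset.sum_add_distrib, p.2.2, q.2.2]; norm_num

/-- After k flattening triples, order n / (ε² √(k + 1)) triples suffice for the statistic, as long
as k ≤ n keeps the number of buckets below 4n. For k near R this equals R up to constants, since
R^(3/2) = n/ε²; if R exceeds n, then k = n leaves √n / ε². -/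
theorem exists_mixtureTester : ∃ C : ℝ, 0 < C ∧ ∀ (n : ℕ) (ε : ℝ), 1 ≤ n → 0 < ε →
    ∃ (m₀ m₁ m₂ : ℕ) (T : Algorithm n m₀ m₁ m₂), IsMixtureTester ε T ∧
      ((m₀ + m₁ + m₂ : ℕ) : ℝ) ≤ C * rate n ε := by
  refine ⟨6000000, by norm_num, fun n ε hn hε => ?_⟩
  have hn0 : (1 : ℝ) ≤ n := by exact_mod_cast hn
  have hn00 : (0 : ℝ) < n := by linarith
  set R : ℝ := (n : ℝ) ^ (2 / 3 : ℝ) / ε ^ (4 / 3 : ℝ) with hR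
  have hR0 : 0 < R := by positivity
  have hR3 : R ^ 3 = n ^ 2 / ε ^ 4 := two_thirds_term_pow_three n hε
  have hrate : rate n ε = √(n : ℝ) / ε ^ 2 + R := rfl
  have hS0 : 0 < √(n : ℝ) / ε ^ 2 := by positivity
  -- No two distributions are more than 2 apart, so for ε > 2 accepting without samples is correct.
  rcases lt_or_ge 2 ε with hε2 | hε2
  · refine ⟨0, 0, 0, fun _ _ _ => 1, fun p q₁ q₂ => ⟨fun _ => ?_, fun hfar => ?_⟩, ?_⟩
    · simp [acceptProb, sampleProb]; norm_num
    · have := hfar q₁ ⟨0, le_rfl, zero_le_one, fun i => by ring⟩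
      exact absurd (this.trans (l1Dist_le_two p q₁)) (not_le.2 hε2)
    · simp only [add_zero, Nat.cast_zero]
      rw [hrate]; positivity
  set k := min n ⌊R⌋₊ with hk
  set X : ℝ := n / (ε ^ 2 * √(k + 1 : ℝ)) with hX
  have hX0 : 0 < X := by positivity
  -- 960000 = 6 · 4 · 40000: √30 ≤ 6, n + 3k ≤ 4n, and 40000 is the constant in the variance
  -- condition.
  set m := ⌈960000 * X⌉₊ with hm
  have hm0 : 960000 * X ≤ m := Nat.le_ceil _
  have hm1 : (m : ℝ) < 960000 * X + 1 := Nat.ceil_lt_add_one (by positivity)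
  have hmpos : (0 : ℝ) < m := lt_of_lt_of_le (by positivity) hm0
  have hkn : (k : ℝ) ≤ n := by exact_mod_cast min_le_left _ _
  have hkR : (k : ℝ) ≤ R := le_trans (by exact_mod_cast min_le_right _ _) (Nat.floor_le hR0.le)
  have hXrate : X ≤ √(n : ℝ) / ε ^ 2 + R := by
    rcases le_total n ⌊R⌋₊ with h | h
    · have hkeq : k = n := min_eq_left h
      have : X ≤ √(n : ℝ) / ε ^ 2 := by
        rw [hX, hkeq, div_le_div_iff₀ (by positivity) (by positivity)]
        have h1 : √(n : ℝ) ≤ √(n + 1 : ℝ) := Real.sqrt_le_sqrt (by linarith)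
        have h2 := Real.mul_self_sqrt hn00.le
        calc (n : ℝ) * ε ^ 2 = √n * √n * ε ^ 2 := by rw [h2]
          _ ≤ √n * √(n + 1 : ℝ) * ε ^ 2 := by gcongr
          _ = _ := by ring
      linarith
    · have hkeq : k = ⌊R⌋₊ := min_eq_right h
      have hRk : R ≤ k + 1 := by rw [hkeq]; exact (Nat.lt_floor_add_one R).le
      have : X ≤ R := by
        rw [hX, div_le_iff₀ (by positivity)]
        have h1 : √R ≤ √(k + 1 : ℝ) := Real.sqrt_le_sqrt hRk
        have h2 : (R * √R) ^ 2 = (n / ε ^ 2) ^ 2 := by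
          rw [mul_pow, Real.sq_sqrt hR0.le, ← pow_succ, hR3, div_pow]; ring
        have h3 : R * √R = n / ε ^ 2 :=
          (pow_left_inj₀ (by positivity) (by positivity) two_ne_zero).1 h2
        calc (n : ℝ) = (n / ε ^ 2) * ε ^ 2 := by field_simp
          _ = R * √R * ε ^ 2 := by rw [h3]
          _ ≤ R * √(k + 1 : ℝ) * ε ^ 2 := by gcongr
          _ = _ := by ring
      linarith
  -- Absorbs the rounding in m; this uses ε ≤ 2.
  have hone : 1 ≤ 4 * (√(n : ℝ) / ε ^ 2) := by
    rw [← mul_div_assoc, one_le_div (by positivity)]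
    have : 1 ≤ √(n : ℝ) := Real.one_le_sqrt.2 hn0
    nlinarith
  refine ⟨k + (m + m), k + (m + m), k + (m + m), mixtureTester n k m (ε ^ 2 / (n + 3 * k)),
    isMixtureTester_mixtureTester hn hε (by exact_mod_cast hmpos) ?_, ?_⟩
  · have h30 : √(30 / (k + 1) : ℝ) ≤ 6 / √(k + 1 : ℝ) := by
      rw [Real.sqrt_div (by norm_num)]
      gcongr
      rw [Real.sqrt_le_left (by norm_num)]; norm_num
    calc √(30 / (k + 1) : ℝ) / m ≤ 6 / √(k + 1 : ℝ) / (960000 * X) := by gcongr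
      _ = ε ^ 2 / (4 * n) / 40000 := by
        rw [hX]; field_simp; norm_num
      _ ≤ ε ^ 2 / (n + 3 * k) / 40000 := by gcongr; linarith
  · rw [hrate]; push_cast; nlinarith

/-! ### The lower bound from testing uniformity -/

/-- Both lower bounds use only inputs with q₁ = q₂, for which being far from the segment means being
far from one point. -/
theorem eq_of_mem_mixtures_self {n : ℕ} {q r : Dist n} (h : r ∈ mixtures q q) : r = q := by
  obtain ⟨x, -, -, hx⟩ := h
  ext i
  calc r.1 i = (1 - x) * q.1 i + x * q.1 i := hx i
    _ = q.1 i := by ring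

theorem self_mem_mixtures {n : ℕ} (q : Dist n) : q ∈ mixtures q q :=
  ⟨0, le_rfl, zero_le_one, fun i => by ring⟩

/-- The second moment method for a mixture of product distributions against a product
distribution. -/
theorem sq_mixture_sub_le {α ι : Type*} [Fintype α] [Fintype ι] {m : ℕ} (ν : ι → ℝ)
    (hν : ∑ z, ν z = 1) (p : ι → α → ℝ) (hp : ∀ z, ∑ i, p z i = 1) (u : α → ℝ)
    (hu0 : ∀ i, 0 ≤ u i) (hu : ∑ i, u i = 1) (hpu : ∀ z i, u i = 0 → p z i = 0)
    (f : (Fin m → α) → ℝ) (hf0 : ∀ x, 0 ≤ f x) (hf1 : ∀ x, f x ≤ 1) :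
    (∑ z, ν z * ∑ x, (∏ j, p z (x j)) * f x - ∑ x, (∏ j, u (x j)) * f x) ^ 2
      ≤ ∑ z, ∑ z', ν z * ν z' * (∑ i, p z i * p z' i / u i) ^ m - 1 := by
  set Q : (Fin m → α) → ℝ := fun x => ∑ z, ν z * ∏ j, p z (x j) with hQ
  set V : (Fin m → α) → ℝ := fun x => ∏ j, u (x j) with hV
  have hV0 : ∀ x, 0 ≤ V x := fun x => Finset.prod_nonneg fun j _ => hu0 _
  -- Absolute continuity, so that the quotients with denominator 0 below really contribute nothing.
  have hQV : ∀ x, V x = 0 → Q x = 0 := by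
    intro x hx
    obtain ⟨j, -, hj⟩ := Finset.prod_eq_zero_iff.1 hx
    refine Finset.sum_eq_zero fun z _ => ?_
    rw [Finset.prod_eq_zero (Finset.mem_univ j) (hpu z _ hj), mul_zero]
  have hVsum : ∑ x, V x = 1 := sum_prod_weight hu m
  have hQsum : ∑ x, Q x = 1 := by
    simp only [hQ]
    rw [Finset.sum_comm]
    simp only [← Finset.mul_sum, sum_prod_weight (hp _), mul_one, hν]
  have h1 : ∑ z, ν z * ∑ x, (∏ j, p z (x j)) * f x - ∑ x, (∏ j, u (x j)) * f x
      = ∑ x, (Q x - V x) * f x := by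
    simp only [sub_mul, Finset.sum_sub_distrib, hQ, Finset.sum_mul, Finset.mul_sum]
    rw [Finset.sum_comm]
    simp only [mul_assoc]
    rfl
  have h2 : (∑ x, (Q x - V x) * f x) ^ 2 ≤ (∑ x, V x) * ∑ x, (Q x - V x) ^ 2 / V x := by
    refine Finset.sum_sq_le_sum_mul_sum_of_sq_le_mul _ (fun x _ => hV0 x)
      (fun x _ => div_nonneg (sq_nonneg _) (hV0 x)) (fun x _ => ?_)
    rcases (hV0 x).eq_or_lt with h | h
    · simp [← h, hQV x h.symm]
    · rw [mul_div_cancel₀ _ h.ne', mul_pow]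
      exact mul_le_of_le_one_right (sq_nonneg _) (pow_le_one₀ (hf0 x) (hf1 x))
  have h3 : ∀ x, (Q x - V x) ^ 2 / V x = Q x ^ 2 / V x - 2 * Q x + V x := by
    intro x
    rcases (hV0 x).eq_or_lt with h | h
    · simp [← h, hQV x h.symm]
    · field_simp; ring
  have h4 : ∑ x, Q x ^ 2 / V x = ∑ z, ∑ z', ν z * ν z' * (∑ i, p z i * p z' i / u i) ^ m := by
    have h5 : ∀ x, Q x ^ 2 / V x
        = ∑ z, ∑ z', ν z * ν z' * ∏ j, (p z (x j) * p z' (x j) / u (x j)) := by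
      intro x
      simp only [hQ, hV, sq, Finset.sum_mul_sum, Finset.sum_div]
      refine Finset.sum_congr rfl fun z _ => Finset.sum_congr rfl fun z' _ => ?_
      rw [Finset.prod_div_distrib, Finset.prod_mul_distrib]
      ring
    simp only [h5, Fintype.sum_pow, Finset.mul_sum]
    rw [Finset.sum_comm]
    exact Finset.sum_congr rfl fun z _ => Finset.sum_comm
  rw [h1]
  refine h2.trans (le_of_eq ?_)
  simp only [h3]
  rw [hVsum, one_mul, Finset.sum_add_distrib, Finset.sum_sub_distrib, ← Finset.mul_sum, hVsum,
    hQsum, h4]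
  ring

/-- The sign of a Boolean. -/
def sgn (b : Bool) : ℝ := if b then 1 else -1

theorem abs_sgn (b : Bool) : |sgn b| = 1 := by cases b <;> simp [sgn]

theorem sum_exp_sgn (t : ℝ) (a : Bool) : ∑ b, Real.exp (t * (sgn a * sgn b)) = 2 * Real.cosh t := by
  rw [Real.cosh_eq]
  cases a <;> simp [sgn] <;> ring

/-- The pairwise perturbation of the uniform distribution on `2 h` elements. -/
noncomputable def perturbed {h : ℕ} (ε : ℝ) (z : Fin h → Bool) (c : Fin h × Bool) : ℝ :=
  (1 + ε * (sgn (z c.1) * sgn c.2)) / (2 * h)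

theorem sum_perturbed {h : ℕ} (hh : 1 ≤ h) (ε : ℝ) (z : Fin h → Bool) :
    ∑ c, perturbed ε z c = 1 := by
  have : (0 : ℝ) < h := by exact_mod_cast hh
  simp only [perturbed, Fintype.sum_prod_type, Fintype.sum_bool]
  have h1 : ∀ x, (1 + ε * (sgn (z x) * sgn true)) / (2 * (h : ℝ))
      + (1 + ε * (sgn (z x) * sgn false)) / (2 * (h : ℝ)) = 1 / h := by
    intro x
    have ht : sgn true = 1 := rfl
    have hf : sgn false = -1 := rfl
    rw [ht, hf]; field_simp; ring
  simp only [h1]; simp; field_simp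

/-- Within each pair the terms linear in ε cancel, leaving only the product of the two signs. -/
theorem sum_perturbed_mul {h : ℕ} (hh : 1 ≤ h) (ε : ℝ) (z z' : Fin h → Bool) :
    ∑ c, perturbed ε z c * perturbed ε z' c / perturbed 0 z c
      = 1 + ε ^ 2 / h * ∑ j, sgn (z j) * sgn (z' j) := by
  have h0 : (0 : ℝ) < h := by exact_mod_cast hh
  simp only [perturbed, Fintype.sum_prod_type, Fintype.sum_bool]
  have h1 : ∀ x, (1 + ε * (sgn (z x) * sgn true)) / (2 * (h : ℝ)) *
      ((1 + ε * (sgn (z' x) * sgn true)) / (2 * h))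
      / ((1 + 0 * (sgn (z x) * sgn true)) / (2 * h)) +
      (1 + ε * (sgn (z x) * sgn false)) / (2 * (h : ℝ)) *
      ((1 + ε * (sgn (z' x) * sgn false)) / (2 * h))
      / ((1 + 0 * (sgn (z x) * sgn false)) / (2 * h))
      = 1 / h + ε ^ 2 / h * (sgn (z x) * sgn (z' x)) := by
    intro x
    have ht : sgn true = 1 := rfl
    have hf : sgn false = -1 := rfl
    rw [ht, hf, zero_mul, zero_mul]
    field_simp; ring
  simp only [h1, Finset.sum_add_distrib, ← Finset.mul_sum]
  simp; field_simp

theorem perturbed_nonneg {h : ℕ} {ε : ℝ} (hε0 : 0 ≤ ε) (hε1 : ε ≤ 1) (z : Fin h → Bool)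
    (c : Fin h × Bool) : 0 ≤ perturbed ε z c := by
  have h1 : |ε * (sgn (z c.1) * sgn c.2)| ≤ 1 := by
    rw [abs_mul, abs_mul, abs_sgn, abs_sgn, abs_of_nonneg hε0]; linarith
  rw [abs_le] at h1
  exact div_nonneg (by linarith) (by positivity)

/-- The second moment of the likelihood ratio of the pairwise perturbations. -/
theorem perturbed_second_moment {h m : ℕ} (hh : 1 ≤ h) {ε : ℝ} (hε0 : 0 ≤ ε) (hε1 : ε ≤ 1) :
    ∑ z : Fin h → Bool, ∑ z' : Fin h → Bool, (1 / 2 : ℝ) ^ h * (1 / 2 : ℝ) ^ h *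
      (∑ c, perturbed ε z c * perturbed ε z' c / perturbed 0 z c) ^ m
      ≤ Real.exp (m ^ 2 * ε ^ 4 / (2 * h)) := by
  have h0 : (0 : ℝ) < h := by exact_mod_cast hh
  have h1 : ∀ z z' : Fin h → Bool, (∑ c, perturbed ε z c * perturbed ε z' c / perturbed 0 z c) ^ m
      ≤ ∏ j, Real.exp ((m * ε ^ 2 / h) * (sgn (z j) * sgn (z' j))) := by
    intro z z'
    have hnn : 0 ≤ ∑ c, perturbed ε z c * perturbed ε z' c / perturbed 0 z c :=
      Finset.sum_nonneg fun c _ => div_nonneg (mul_nonneg (perturbed_nonneg hε0 hε1 z c)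
        (perturbed_nonneg hε0 hε1 z' c)) (perturbed_nonneg le_rfl zero_le_one z c)
    rw [← Real.exp_sum, ← Finset.mul_sum]
    rw [sum_perturbed_mul hh] at hnn ⊢
    calc _ ≤ (Real.exp (ε ^ 2 / h * ∑ j, sgn (z j) * sgn (z' j))) ^ m := by
          refine pow_le_pow_left₀ hnn ?_ m
          rw [add_comm]; exact Real.add_one_le_exp _
      _ = _ := by rw [← Real.exp_nat_mul]; congr 1; ring
  calc _ ≤ ∑ z : Fin h → Bool, ∑ z' : Fin h → Bool, (1 / 2 : ℝ) ^ h * (1 / 2 : ℝ) ^ h *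
        ∏ j, Real.exp ((m * ε ^ 2 / h) * (sgn (z j) * sgn (z' j))) := by
        gcongr with z _ z'; exact h1 z z'
    -- For fixed z the coordinates of z' are independent, and averaging over a sign turns each
    -- exponential into a hyperbolic cosine.
    _ = Real.cosh (m * ε ^ 2 / h) ^ h := by
        have h2 : ∀ z : Fin h → Bool, ∑ z' : Fin h → Bool,
            ∏ j, Real.exp ((m * ε ^ 2 / h) * (sgn (z j) * sgn (z' j)))
            = (2 * Real.cosh (m * ε ^ 2 / h)) ^ h := by
          intro z
          rw [← Fintype.prod_sum (fun j b => Real.exp ((m * ε ^ 2 / h) * (sgn (z j) * sgn b)))]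
          simp only [sum_exp_sgn]; simp
        simp only [← Finset.mul_sum, h2]
        simp only [Finset.sum_const, Finset.card_univ, Fintype.card_pi, Fintype.card_bool,
          Finset.prod_const, Fintype.card_fin, nsmul_eq_mul]
        push_cast
        rw [← mul_pow, ← mul_pow, ← mul_pow]
        congr 1; ring
    _ ≤ Real.exp ((m * ε ^ 2 / h) ^ 2 / 2) ^ h :=
        pow_le_pow_left₀ (Real.cosh_pos _).le (Real.cosh_le_exp_half_sq _) h
    _ = _ := by rw [← Real.exp_nat_mul]; congr 1; field_simp

theorem sum_extend {α β : Type*} [Fintype α] [Fintype β] (e : β ↪ α) (v : β → ℝ) :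
    ∑ i, Function.extend e v 0 i = ∑ c, v c :=
  (Fintype.sum_of_injective e e.injective v _ (fun i hi => by
    rw [Function.extend_apply' _ _ _ (by simpa using hi)]; rfl)
    (fun c => by rw [e.injective.extend_apply])).symm

/-- The distribution on `n` elements obtained from one on an embedded finite type. -/
noncomputable def extendDist {n : ℕ} {β : Type*} [Fintype β] (e : β ↪ Fin n) (v : β → ℝ)
    (hv0 : ∀ c, 0 ≤ v c) (hv : ∑ c, v c = 1) : Dist n :=
  ⟨Function.extend e v 0, fun i => by
    by_cases h : ∃ c, e c = i
    · obtain ⟨c, rfl⟩ := h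
      rw [e.injective.extend_apply]; exact hv0 c
    · rw [Function.extend_apply' _ _ _ h]; rfl, by rw [sum_extend, hv]⟩

/-- The probability of accepting the samples `x` from the first distribution. -/
noncomputable def acceptGiven {n m₀ m₁ m₂ : ℕ} (T : Algorithm n m₀ m₁ m₂) (q₁ q₂ : Dist n)
    (x : Fin m₀ → Fin n) : ℝ :=
  ∑ y : Fin m₁ → Fin n, ∑ z : Fin m₂ → Fin n, sampleProb q₁ y * sampleProb q₂ z * (T x y z : ℝ)

theorem sampleProb_nonneg {n m : ℕ} (p : Dist n) (x : Fin m → Fin n) : 0 ≤ sampleProb p x :=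
  Finset.prod_nonneg fun _ _ => p.2.1 _

theorem sum_sampleProb {n : ℕ} (p : Dist n) (m : ℕ) : ∑ x : Fin m → Fin n, sampleProb p x = 1 :=
  sum_prod_weight p.2.2 m

theorem acceptProb_eq_acceptGiven {n m₀ m₁ m₂ : ℕ} (T : Algorithm n m₀ m₁ m₂) (p q₁ q₂ : Dist n) :
    acceptProb T p q₁ q₂ = ∑ x, (∏ j, p.1 (x j)) * acceptGiven T q₁ q₂ x := by
  simp only [acceptProb, acceptGiven, sampleProb, Finset.mul_sum, mul_assoc]

theorem acceptGiven_nonneg {n m₀ m₁ m₂ : ℕ} (T : Algorithm n m₀ m₁ m₂) (q₁ q₂ : Dist n)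
    (x : Fin m₀ → Fin n) : 0 ≤ acceptGiven T q₁ q₂ x :=
  Finset.sum_nonneg fun y _ => Finset.sum_nonneg fun z _ =>
    mul_nonneg (mul_nonneg (sampleProb_nonneg _ _) (sampleProb_nonneg _ _)) (T x y z).2.1

theorem acceptGiven_le_one {n m₀ m₁ m₂ : ℕ} (T : Algorithm n m₀ m₁ m₂) (q₁ q₂ : Dist n)
    (x : Fin m₀ → Fin n) : acceptGiven T q₁ q₂ x ≤ 1 := by
  calc acceptGiven T q₁ q₂ x
      ≤ ∑ y : Fin m₁ → Fin n, ∑ z : Fin m₂ → Fin n, sampleProb q₁ y * sampleProb q₂ z :=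
        Finset.sum_le_sum fun y _ => Finset.sum_le_sum fun z _ => mul_le_of_le_one_right
          (mul_nonneg (sampleProb_nonneg _ _) (sampleProb_nonneg _ _)) (T x y z).2.2
    _ = 1 := by simp only [← Finset.mul_sum, sum_sampleProb, mul_one]

/-- Testing uniformity needs `√n / ε²` samples from the first distribution. -/
theorem sqrt_lower_bound {n : ℕ} {ε : ℝ} (hn : 2 ≤ n) (hε0 : 0 < ε) (hε1 : ε ≤ 1) {m₀ m₁ m₂ : ℕ}
    {T : Algorithm n m₀ m₁ m₂} (hT : IsMixtureTester ε T) :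
    1 / 6 * (√(n : ℝ) / ε ^ 2) ≤ m₀ := by
  set h := n / 2 with hh
  have hh1 : 1 ≤ h := by omega
  have hn3 : (n : ℝ) ≤ 3 * h := by
    have : n ≤ 3 * h := by omega
    exact_mod_cast this
  have hh0 : (0 : ℝ) < h := by exact_mod_cast hh1
  obtain ⟨e⟩ : Nonempty (Fin h × Bool ↪ Fin n) := by
    apply Function.Embedding.nonempty_of_card_le
    simp; omega
  -- With perturbation 0 the signs are irrelevant: this only names the uniform distribution.
  have z₀ : Fin h → Bool := fun _ => true
  set p : (Fin h → Bool) → Dist n := fun z =>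
    extendDist e (perturbed ε z) (perturbed_nonneg hε0.le hε1 z) (sum_perturbed hh1 ε z) with hp
  set u : Dist n := extendDist e (perturbed 0 z₀) (perturbed_nonneg le_rfl zero_le_one z₀)
    (sum_perturbed hh1 0 z₀) with hu
  have hpe : ∀ z c, (p z).1 (e c) = perturbed ε z c := fun z c => e.injective.extend_apply _ _ c
  have hue : ∀ c, u.1 (e c) = perturbed 0 z₀ c := fun c => e.injective.extend_apply _ _ c
  have hp' : ∀ z i, (¬ ∃ c, e c = i) → (p z).1 i = 0 := fun z i hi =>
    Function.extend_apply' _ _ _ hi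
  have hu' : ∀ i, (¬ ∃ c, e c = i) → u.1 i = 0 := fun i hi =>
    Function.extend_apply' _ _ _ hi
  have hpos : ∀ c, 0 < perturbed 0 z₀ c := fun c => by
    simp only [perturbed, zero_mul, add_zero]; positivity
  have hfar : ∀ z, IsFar ε (p z) (mixtures u u) := by
    intro z r hr
    rw [eq_of_mem_mixtures_self hr]
    refine le_of_eq ?_
    rw [l1Dist, ← Fintype.sum_of_injective e e.injective (fun _ => ε / (2 * h)) _
      (fun i hi => by
        rw [hp' z i (by simpa using hi), hu' i (by simpa using hi), sub_zero, abs_zero])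
      (fun c => by
        rw [hpe, hue, perturbed, perturbed, ← sub_div, abs_div, zero_mul, add_zero,
          add_sub_cancel_left, abs_mul, abs_mul, abs_sgn, abs_sgn, abs_of_pos hε0,
          abs_of_pos (by positivity : (0 : ℝ) < 2 * h)]
        ring)]
    simp
    field_simp
  have hsq := sq_mixture_sub_le (m := m₀) (fun _ : Fin h → Bool => (1 / 2 : ℝ) ^ h)
    (by simp) (fun z => (p z).1) (fun z => (p z).2.2) u.1 u.2.1 u.2.2 (fun z i hi => by
      by_cases hc : ∃ c, e c = i
      · obtain ⟨c, rfl⟩ := hc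
        rw [hue] at hi
        exact absurd hi (hpos c).ne'
      · exact hp' z i hc)
    (acceptGiven T u u) (acceptGiven_nonneg T u u) (acceptGiven_le_one T u u)
  have hmom : ∀ z z', ∑ i, (p z).1 i * (p z').1 i / u.1 i
      = ∑ c, perturbed ε z c * perturbed ε z' c / perturbed 0 z c := fun z z' =>
    (Fintype.sum_of_injective e e.injective _ _ (fun i hi => by
      rw [hp' z i (by simpa using hi), zero_mul, zero_div])
      (fun c => by rw [hpe, hpe, hue]; simp [perturbed])).symm
  simp only [hmom, ← acceptProb_eq_acceptGiven] at hsq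
  have hexp := perturbed_second_moment (m := m₀) hh1 hε0.le hε1
  have hyes := (hT u u u).1 (self_mem_mixtures u)
  have hno : ∑ z : Fin h → Bool, (1 / 2 : ℝ) ^ h * acceptProb T (p z) u u ≤ 1 / 3 := by
    calc _ ≤ ∑ z : Fin h → Bool, (1 / 2 : ℝ) ^ h * (1 / 3) := by
          gcongr with z
          linarith [(hT (p z) u u).2 (hfar z)]
      _ = 1 / 3 := by simp
  -- The acceptance probabilities 2/3 and 1/3 differ by 1/3, whose square is 1/9.
  have h19 : 1 / 9 ≤ Real.exp (m₀ ^ 2 * ε ^ 4 / (2 * h)) - 1 := by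
    have : (1 / 9 : ℝ) ≤ (∑ z : Fin h → Bool, (1 / 2 : ℝ) ^ h * acceptProb T (p z) u u
        - acceptProb T u u u) ^ 2 := by nlinarith
    linarith
  -- For y < 1/20, exp y ≤ 1 / (1 - y) < 20/19 < 10/9.
  have hy : 1 / 20 ≤ m₀ ^ 2 * ε ^ 4 / (2 * h) := by
    by_contra! hlt
    set y := m₀ ^ 2 * ε ^ 4 / (2 * h)
    have h1 : 1 - y ≤ Real.exp (-y) := by linarith [Real.add_one_le_exp (-y)]
    have h2 : Real.exp (-y) * Real.exp y = 1 := by rw [← Real.exp_add]; simp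
    nlinarith [Real.exp_pos y]
  rw [le_div_iff₀ (by positivity)] at hy
  have hfin : √(n : ℝ) ≤ 6 * ε ^ 2 * m₀ := by
    rw [Real.sqrt_le_left (by positivity)]
    nlinarith
  rw [← mul_div_assoc, div_le_iff₀ (by positivity)]
  linarith

/-! ### From sequences to independent counts -/

/-- The number of occurrences of `i` in the sequence `x`. -/
def counts {α : Type*} [DecidableEq α] {N : ℕ} (x : Fin N → α) (i : α) : ℕ :=
  (Finset.univ.filter fun j => x j = i).card

theorem prod_eq_prod_pow_counts {α R : Type*} [Fintype α] [DecidableEq α] [CommMonoid R] {N : ℕ}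
    (r : α → R) (x : Fin N → α) : ∏ j, r (x j) = ∏ i, r i ^ counts x i := by
  rw [← Finset.prod_fiberwise _ x]
  refine Finset.prod_congr rfl fun i _ => ?_
  rw [counts, ← Finset.prod_const]
  exact Finset.prod_congr rfl fun j hj => by rw [(Finset.mem_filter.1 hj).2]

/-- Summing a function of the counts over all sequences of length `N`. -/
theorem sum_counts {α : Type*} [Fintype α] [DecidableEq α] (N : ℕ) (g : (α → ℕ) → ℝ) :
    ∑ x : Fin N → α, g (counts x)
      = ∑ c ∈ Finset.univ.piAntidiag N, (Nat.multinomial Finset.univ c : ℝ) * g c := by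
  have h1 : ∀ c : α → ℕ, ∏ i, (MvPolynomial.X i : MvPolynomial α ℝ) ^ c i
      = MvPolynomial.monomial (Finsupp.equivFunOnFinite.symm c) 1 := by
    intro c
    rw [MvPolynomial.monomial_eq, Finsupp.prod_fintype _ _ (fun i => pow_zero _)]
    simp
  have h2 := Finset.sum_pow_eq_sum_piAntidiag (Finset.univ : Finset α)
    (fun i => (MvPolynomial.X i : MvPolynomial α ℝ)) N
  rw [Fintype.sum_pow] at h2
  simp only [prod_eq_prod_pow_counts, h1] at h2
  -- Apply to the multinomial theorem the linear functional that sends the monomial with exponent c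
  -- to g c.
  have h3 := congrArg ((MvPolynomial.basisMonomials α ℝ).constr ℝ
    (fun s : α →₀ ℕ => g (Finsupp.equivFunOnFinite s))) h2
  have h4 : ∀ c : α → ℕ, (MvPolynomial.basisMonomials α ℝ).constr ℝ
      (fun s : α →₀ ℕ => g (Finsupp.equivFunOnFinite s))
      (MvPolynomial.monomial (Finsupp.equivFunOnFinite.symm c) 1) = g c := by
    intro c
    have := (MvPolynomial.basisMonomials α ℝ).constr_basis ℝ
      (fun s : α →₀ ℕ => g (Finsupp.equivFunOnFinite s)) (Finsupp.equivFunOnFinite.symm c)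
    rw [MvPolynomial.coe_basisMonomials] at this
    simpa using this
  simp only [map_sum, ← nsmul_eq_mul, map_nsmul, h4] at h3
  simpa only [nsmul_eq_mul] using h3

/-- Sequences of length at most `L`. -/
abbrev Lists (α : Type*) (L : ℕ) : Type _ := Σ N : Fin (L + 1), (Fin N → α)

/-- The Poisson weight `1 / N!` of a sequence of length `N`. -/
noncomputable def listWeight {α : Type*} {L : ℕ} (ξ : Lists α L) : ℝ := 1 / (ξ.1.1.factorial : ℝ)

theorem listWeight_nonneg {α : Type*} {L : ℕ} (ξ : Lists α L) : 0 ≤ listWeight ξ := by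
  unfold listWeight; positivity

/-- The count vectors with entries at most `L`. -/
def box (α : Type*) [Fintype α] [DecidableEq α] (L : ℕ) : Finset (α → ℕ) :=
  Fintype.piFinset fun _ => Finset.range (L + 1)

/-- The weighted sum over sequences is at most the sum over count vectors. -/
theorem sum_lists_le {α : Type*} [Fintype α] [DecidableEq α] (L : ℕ) (g : (α → ℕ) → ℝ)
    (hg : ∀ c, 0 ≤ g c) :
    ∑ ξ : Lists α L, listWeight ξ * g (counts ξ.2)
      ≤ ∑ c ∈ box α L, (∏ i, 1 / ((c i).factorial : ℝ)) * g c := by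
  have hnn : ∀ c : α → ℕ, 0 ≤ (∏ i, 1 / ((c i).factorial : ℝ)) * g c := fun c =>
    mul_nonneg (Finset.prod_nonneg fun i _ => by positivity) (hg c)
  have h1 : ∀ N : ℕ, ∑ x : Fin N → α, 1 / (N.factorial : ℝ) * g (counts x)
      = ∑ c ∈ Finset.univ.piAntidiag N, (∏ i, 1 / ((c i).factorial : ℝ)) * g c := by
    intro N
    rw [← Finset.mul_sum, sum_counts, Finset.mul_sum]
    refine Finset.sum_congr rfl fun c hc => ?_
    have hs := Nat.multinomial_spec Finset.univ c
    rw [(Finset.mem_piAntidiag.1 hc).1] at hs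
    have hs' : (∏ i, ((c i).factorial : ℝ)) * (Nat.multinomial Finset.univ c : ℝ)
        = (N.factorial : ℝ) := by exact_mod_cast hs
    have hp : (∏ i, ((c i).factorial : ℝ)) ≠ 0 :=
      Finset.prod_ne_zero_iff.2 fun i _ => by positivity
    rw [Finset.prod_div_distrib, Finset.prod_const_one, ← hs', ← mul_assoc]
    congr 1
    have hm : (Nat.multinomial Finset.univ c : ℝ) ≠ 0 := by
      intro h0
      rw [h0, mul_zero] at hs'
      exact (by positivity : (N.factorial : ℝ) ≠ 0) hs'.symm
    field_simp
  rw [Fintype.sum_sigma]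
  simp only [listWeight, h1]
  rw [Fin.sum_univ_eq_sum_range (fun N => ∑ c ∈ Finset.univ.piAntidiag N,
    (∏ i, 1 / ((c i).factorial : ℝ)) * g c)]
  -- Total count at most L forces every entry to be at most L, but not conversely, hence only an
  -- inequality.
  calc _ ≤ ∑ N ∈ Finset.range (L + 1), ∑ c ∈ box α L with ∑ i, c i = N,
        (∏ i, 1 / ((c i).factorial : ℝ)) * g c := by
        refine Finset.sum_le_sum fun N hN => Finset.sum_le_sum_of_subset_of_nonneg ?_
          (fun c _ _ => hnn c)
        intro c hc
        have hc' : ∑ i, c i = N := (Finset.mem_piAntidiag.1 hc).1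
        rw [Finset.mem_filter, box, Fintype.mem_piFinset]
        refine ⟨fun i => ?_, hc'⟩
        have : c i ≤ ∑ i, c i := Finset.single_le_sum (fun _ _ => Nat.zero_le _) (Finset.mem_univ i)
        rw [Finset.mem_range] at hN ⊢
        omega
    _ ≤ _ := Finset.sum_fiberwise_le_sum_of_sum_fiber_nonneg fun N _ =>
        Finset.sum_nonneg fun c _ => hnn c

/-- The weighted double sum over a square of counts. -/
noncomputable def cellSum (L : ℕ) (H : ℕ → ℕ → ℝ) : ℝ :=
  ∑ a ∈ Finset.range (L + 1), ∑ b ∈ Finset.range (L + 1),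
    1 / (a.factorial : ℝ) * (1 / (b.factorial : ℝ)) * H a b

theorem cellSum_nonneg {L : ℕ} {H : ℕ → ℕ → ℝ} (hH : ∀ a b, 0 ≤ H a b) : 0 ≤ cellSum L H :=
  Finset.sum_nonneg fun a _ => Finset.sum_nonneg fun b _ => mul_nonneg (by positivity) (hH a b)

/-- The box is a product set, unlike the set of count vectors with bounded total; this is why sums
are enlarged to it. -/
theorem sum_box_prod {α : Type*} [Fintype α] [DecidableEq α] (L : ℕ) (H : α → ℕ → ℕ → ℝ) :
    ∑ c ∈ box α L, (∏ i, 1 / ((c i).factorial : ℝ)) * ∑ d ∈ box α L,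
      (∏ i, 1 / ((d i).factorial : ℝ)) * ∏ i, H i (c i) (d i) = ∏ i, cellSum L (H i) := by
  have h1 : ∀ c : α → ℕ, (∏ i, 1 / ((c i).factorial : ℝ)) * ∑ d ∈ box α L,
      (∏ i, 1 / ((d i).factorial : ℝ)) * ∏ i, H i (c i) (d i)
      = ∏ i, (∑ b ∈ Finset.range (L + 1),
        1 / ((c i).factorial : ℝ) * (1 / (b.factorial : ℝ)) * H i (c i) b) := by
    intro c
    rw [Finset.prod_univ_sum, Finset.mul_sum]
    refine Finset.sum_congr rfl fun d _ => ?_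
    rw [← Finset.prod_mul_distrib, ← Finset.prod_mul_distrib]
    exact Finset.prod_congr rfl fun i _ => by ring
  simp only [h1, cellSum]
  exact (Finset.prod_univ_sum (fun _ => Finset.range (L + 1)) (fun i a =>
    ∑ b ∈ Finset.range (L + 1), 1 / (a.factorial : ℝ) * (1 / (b.factorial : ℝ)) * H i a b)).symm

theorem sum_lists_lists_le {α : Type*} [Fintype α] [DecidableEq α] (L : ℕ)
    (g : (α → ℕ) → (α → ℕ) → ℝ) (hg : ∀ c d, 0 ≤ g c d) :
    ∑ ξ : Lists α L, ∑ η : Lists α L, listWeight ξ * listWeight η * g (counts ξ.2) (counts η.2)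
      ≤ ∑ c ∈ box α L, (∏ i, 1 / ((c i).factorial : ℝ)) * ∑ d ∈ box α L,
      (∏ i, 1 / ((d i).factorial : ℝ)) * g c d := by
  have h1 : ∀ ξ : Lists α L, ∑ η : Lists α L,
      listWeight ξ * listWeight η * g (counts ξ.2) (counts η.2)
      ≤ listWeight ξ * ∑ d ∈ box α L, (∏ i, 1 / ((d i).factorial : ℝ)) * g (counts ξ.2) d := by
    intro ξ
    simp only [mul_assoc]
    rw [← Finset.mul_sum]
    exact mul_le_mul_of_nonneg_left (sum_lists_le L (g (counts ξ.2)) (hg _)) (listWeight_nonneg ξ)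
  refine (Finset.sum_le_sum fun ξ _ => h1 ξ).trans ?_
  refine sum_lists_le L (fun c => ∑ d ∈ box α L, (∏ i, 1 / ((d i).factorial : ℝ)) * g c d)
    (fun c => Finset.sum_nonneg fun d _ => mul_nonneg (Finset.prod_nonneg fun i _ => ?_) (hg c d))
  positivity

/-- The second moment method for two product measures on pairs of count vectors. -/
theorem sq_lists_sub_le {α : Type*} [Fintype α] [DecidableEq α] (L : ℕ) (F G : α → ℕ → ℕ → ℝ)
    (hF : ∀ i a b, 0 < F i a b) (f : Lists α L → Lists α L → ℝ)
    (hf0 : ∀ ξ η, 0 ≤ f ξ η) (hf1 : ∀ ξ η, f ξ η ≤ 1) :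
    (∑ ξ : Lists α L, ∑ η : Lists α L, listWeight ξ * listWeight η *
        (∏ i, G i (counts ξ.2 i) (counts η.2 i)
          - ∏ i, F i (counts ξ.2 i) (counts η.2 i)) * f ξ η) ^ 2
      ≤ (∏ i, cellSum L (F i)) * (∏ i, cellSum L (fun a b => G i a b ^ 2 / F i a b)
        - 2 * ∏ i, cellSum L (G i) + ∏ i, cellSum L (F i)) := by
  set A : (α → ℕ) → (α → ℕ) → ℝ := fun c d => ∏ i, F i (c i) (d i) with hA
  set B : (α → ℕ) → (α → ℕ) → ℝ := fun c d => ∏ i, G i (c i) (d i) with hB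
  have hA0 : ∀ c d, 0 < A c d := fun c d => Finset.prod_pos fun i _ => hF _ _ _
  have h1 : ∑ ξ : Lists α L, ∑ η : Lists α L,
      listWeight ξ * listWeight η * A (counts ξ.2) (counts η.2)
      ≤ ∏ i, cellSum L (F i) := by
    rw [← sum_box_prod]
    exact sum_lists_lists_le L A fun c d => (hA0 c d).le
  have h2 : ∑ ξ : Lists α L, ∑ η : Lists α L, listWeight ξ * listWeight η *
      ((B (counts ξ.2) (counts η.2) - A (counts ξ.2) (counts η.2)) ^ 2
        / A (counts ξ.2) (counts η.2))
      ≤ ∏ i, cellSum L (fun a b => G i a b ^ 2 / F i a b)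
        - 2 * ∏ i, cellSum L (G i) + ∏ i, cellSum L (F i) := by
    refine (sum_lists_lists_le L (fun c d => (B c d - A c d) ^ 2 / A c d)
      (fun c d => div_nonneg (sq_nonneg _) (hA0 c d).le)).trans (le_of_eq ?_)
    rw [← sum_box_prod, ← sum_box_prod, ← sum_box_prod]
    simp only [Finset.mul_sum, ← Finset.sum_add_distrib, ← Finset.sum_sub_distrib]
    refine Finset.sum_congr rfl fun c _ => Finset.sum_congr rfl fun d _ => ?_
    have : ∏ i, G i (c i) (d i) ^ 2 / F i (c i) (d i) = B c d ^ 2 / A c d := by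
      rw [Finset.prod_div_distrib, Finset.prod_pow]
    rw [this]
    have h3 : (B c d - A c d) ^ 2 / A c d = B c d ^ 2 / A c d - 2 * B c d + A c d := by
      have := (hA0 c d).ne'
      field_simp; ring
    rw [h3]
    simp only [hA, hB]
    ring
  have hnn : 0 ≤ ∏ i, cellSum L (F i) :=
    Finset.prod_nonneg fun i _ => cellSum_nonneg fun a b => (hF i a b).le
  have hcs := Finset.sum_sq_le_sum_mul_sum_of_sq_le_mul
    (Finset.univ : Finset (Lists α L × Lists α L))
    (r := fun z => listWeight z.1 * listWeight z.2 *
      (B (counts z.1.2) (counts z.2.2) - A (counts z.1.2) (counts z.2.2)) * f z.1 z.2)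
    (f := fun z => listWeight z.1 * listWeight z.2 * A (counts z.1.2) (counts z.2.2))
    (g := fun z => listWeight z.1 * listWeight z.2 *
      ((B (counts z.1.2) (counts z.2.2) - A (counts z.1.2) (counts z.2.2)) ^ 2
        / A (counts z.1.2) (counts z.2.2)))
    (fun z _ => mul_nonneg (mul_nonneg (listWeight_nonneg _) (listWeight_nonneg _)) (hA0 _ _).le)
    (fun z _ => mul_nonneg (mul_nonneg (listWeight_nonneg _) (listWeight_nonneg _))
      (div_nonneg (sq_nonneg _) (hA0 _ _).le))
    (fun z _ => by
      have := (hA0 (counts z.1.2) (counts z.2.2)).ne'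
      have hf2 : f z.1 z.2 ^ 2 ≤ 1 := pow_le_one₀ (hf0 _ _) (hf1 _ _)
      calc _ = (listWeight z.1 * listWeight z.2 *
            (B (counts z.1.2) (counts z.2.2) - A (counts z.1.2) (counts z.2.2))) ^ 2
              * f z.1 z.2 ^ 2 := by ring
        _ ≤ (listWeight z.1 * listWeight z.2 *
            (B (counts z.1.2) (counts z.2.2) - A (counts z.1.2) (counts z.2.2))) ^ 2 :=
            mul_le_of_le_one_right (sq_nonneg _) hf2
        _ = _ := by field_simp)
  simp only [Fintype.sum_prod_type] at hcs
  refine hcs.trans (mul_le_mul h1 h2 ?_ hnn)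
  exact Finset.sum_nonneg fun ξ _ => Finset.sum_nonneg fun η _ =>
    mul_nonneg (mul_nonneg (listWeight_nonneg _) (listWeight_nonneg _))
      (div_nonneg (sq_nonneg _) (hA0 _ _).le)

/-! ### Indistinguishable Poisson mixtures -/

open Filter Topology

/-- The likelihood of a sequence under a Poisson process with rates `r`. -/
noncomputable def listLik {α : Type*} [Fintype α] {L : ℕ} (r : α → ℝ) (ξ : Lists α L) : ℝ :=
  listWeight ξ * (Real.exp (-∑ i, r i) * ∏ j, r (ξ.2 j))

/-- The likelihood (up to factorials) of the counts `a`, `b` of a single element whose two rates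
are drawn from the prior `w`. -/
noncomputable def cellLik {τ : Type*} [Fintype τ] (w r s : τ → ℝ) (a b : ℕ) : ℝ :=
  ∑ u, w u * (Real.exp (-(r u + s u)) * (r u ^ a * s u ^ b))

/-- The likelihood depends only on the counts and the prior is independent across elements, so the
mixture factors over elements. -/
theorem sum_prior_listLik {α τ : Type*} [Fintype α] [DecidableEq α] [Fintype τ] {L : ℕ}
    (w : τ → ℝ) (r s : α → τ → ℝ) (ξ η : Lists α L) :
    ∑ t : α → τ, (∏ i, w (t i)) *
        (listLik (fun i => r i (t i)) ξ * listLik (fun i => s i (t i)) η)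
      = listWeight ξ * listWeight η *
        ∏ i, cellLik w (r i) (s i) (counts ξ.2 i) (counts η.2 i) := by
  simp only [cellLik]
  rw [Fintype.prod_sum, Finset.mul_sum]
  refine Finset.sum_congr rfl fun t _ => ?_
  simp only [listLik]
  rw [prod_eq_prod_pow_counts (fun i => r i (t i)), prod_eq_prod_pow_counts (fun i => s i (t i)),
    Finset.prod_mul_distrib, Finset.prod_mul_distrib, Finset.prod_mul_distrib, ← Real.exp_sum,
    Finset.sum_neg_distrib, Finset.sum_add_distrib, neg_add, Real.exp_add]
  ring

/-- The probability that a Poisson variable with mean `r` is at most `L`. -/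
noncomputable def poissonCdf (L : ℕ) (r : ℝ) : ℝ :=
  Real.exp (-r) * ∑ a ∈ Finset.range (L + 1), r ^ a / (a.factorial : ℝ)

theorem poissonCdf_nonneg (L : ℕ) {r : ℝ} (hr : 0 ≤ r) : 0 ≤ poissonCdf L r :=
  mul_nonneg (Real.exp_pos _).le (Finset.sum_nonneg fun _ _ => by positivity)

theorem poissonCdf_le_one (L : ℕ) {r : ℝ} (hr : 0 ≤ r) : poissonCdf L r ≤ 1 := by
  calc poissonCdf L r ≤ Real.exp (-r) * Real.exp r :=
        mul_le_mul_of_nonneg_left (Real.sum_le_exp_of_nonneg hr _) (Real.exp_pos _).le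
    _ = 1 := by rw [← Real.exp_add]; simp

theorem tendsto_poissonCdf (r : ℝ) : Tendsto (fun L => poissonCdf L r) atTop (𝓝 1) := by
  have h : HasSum (fun a : ℕ => r ^ a / (a.factorial : ℝ)) (Real.exp r) := by
    rw [Real.exp_eq_exp_ℝ]
    exact NormedSpace.expSeries_div_hasSum_exp r
  have h1 := ((tendsto_add_atTop_iff_nat 1).2 h.tendsto_sum_nat).const_mul (Real.exp (-r))
  have h2 : Real.exp (-r) * Real.exp r = 1 := by rw [← Real.exp_add]; simp
  rw [h2] at h1
  exact h1

section
variable {τ : Type*} [Fintype τ] {w r s : τ → ℝ}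

theorem cellSum_cellLik (w r s : τ → ℝ) (L : ℕ) :
    cellSum L (cellLik w r s) = ∑ u, w u * (poissonCdf L (r u) * poissonCdf L (s u)) := by
  simp only [cellSum, cellLik, Finset.mul_sum]
  have h : ∀ u, w u * (poissonCdf L (r u) * poissonCdf L (s u))
      = ∑ a ∈ Finset.range (L + 1), ∑ b ∈ Finset.range (L + 1),
        1 / (a.factorial : ℝ) * (1 / (b.factorial : ℝ)) *
          (w u * (Real.exp (-(r u + s u)) * (r u ^ a * s u ^ b))) := by
    intro u
    rw [poissonCdf, poissonCdf, mul_mul_mul_comm, Finset.sum_mul_sum, ← Real.exp_add,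
      Finset.mul_sum, Finset.mul_sum]
    refine Finset.sum_congr rfl fun a _ => ?_
    rw [Finset.mul_sum, Finset.mul_sum]
    refine Finset.sum_congr rfl fun b _ => ?_
    rw [neg_add]; ring
  simp only [h]
  rw [Finset.sum_comm]
  have h2 : ∀ a : ℕ, ∑ b ∈ Finset.range (L + 1), ∑ u, 1 / (a.factorial : ℝ) *
      (1 / (b.factorial : ℝ)) * (w u * (Real.exp (-(r u + s u)) * (r u ^ a * s u ^ b)))
      = ∑ u, ∑ b ∈ Finset.range (L + 1), 1 / (a.factorial : ℝ) * (1 / (b.factorial : ℝ)) *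
        (w u * (Real.exp (-(r u + s u)) * (r u ^ a * s u ^ b))) := fun a => Finset.sum_comm
  rw [Finset.sum_comm]
  simp only [h2]
  rw [Finset.sum_comm]

theorem cellSum_cellLik_le_one (hw0 : ∀ u, 0 ≤ w u) (hw : ∑ u, w u = 1) (hr : ∀ u, 0 ≤ r u)
    (hs : ∀ u, 0 ≤ s u) (L : ℕ) : cellSum L (cellLik w r s) ≤ 1 := by
  rw [cellSum_cellLik, ← hw]
  exact Finset.sum_le_sum fun u _ => mul_le_of_le_one_right (hw0 u)
    (mul_le_one₀ (poissonCdf_le_one L (hr u)) (poissonCdf_nonneg L (hs u))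
      (poissonCdf_le_one L (hs u)))

theorem tendsto_cellSum_cellLik (hw : ∑ u, w u = 1) (r s : τ → ℝ) :
    Tendsto (fun L => cellSum L (cellLik w r s)) atTop (𝓝 1) := by
  simp only [cellSum_cellLik]
  have h : Tendsto (fun L => ∑ u, w u * (poissonCdf L (r u) * poissonCdf L (s u))) atTop
      (𝓝 (∑ u, w u * (1 * 1))) :=
    tendsto_finsetSum _ fun u _ =>
      ((tendsto_poissonCdf (r u)).mul (tendsto_poissonCdf (s u))).const_mul (w u)
  simpa [hw] using h

end

/-- Truncation at L leaves total masses below 1, so they are kept explicitly instead of writing 1 +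
χ². -/
theorem cellSum_sq_div {F G : ℕ → ℕ → ℝ} (hF : ∀ a b, 0 < F a b) (L : ℕ) :
    cellSum L (fun a b => G a b ^ 2 / F a b) = 2 * cellSum L G - cellSum L F
      + cellSum L (fun a b => (G a b - F a b) ^ 2 / F a b) := by
  simp only [cellSum, Finset.mul_sum, ← Finset.sum_sub_distrib, ← Finset.sum_add_distrib]
  refine Finset.sum_congr rfl fun a _ => Finset.sum_congr rfl fun b _ => ?_
  have := (hF a b).ne'
  field_simp; ring

/-- Two Poisson mixtures with independent elements are hard to distinguish if the sum of the
`χ²`-divergences of the elements is small. -/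
theorem poisson_mixtures_close {α τ : Type*} [Fintype α] [DecidableEq α] [Fintype τ] {w : τ → ℝ}
    (hw0 : ∀ u, 0 ≤ w u) (hw : ∑ u, w u = 1) {r s r' s' : α → τ → ℝ} (hr : ∀ i u, 0 ≤ r i u)
    (hs : ∀ i u, 0 ≤ s i u)
    (hF : ∀ i a b, 0 < cellLik w (r i) (s i) a b) {χ : ℝ}
    (hχ : ∀ i L, cellSum L (fun a b => (cellLik w (r' i) (s' i) a b - cellLik w (r i) (s i) a b) ^ 2
      / cellLik w (r i) (s i) a b) ≤ χ) (hcard : Fintype.card α * χ ≤ 1 / 200) :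
    ∀ᶠ L in atTop, ∀ f : Lists α L → Lists α L → ℝ, (∀ ξ η, 0 ≤ f ξ η) → (∀ ξ η, f ξ η ≤ 1) →
      (∑ t : α → τ, (∏ i, w (t i)) * ∑ ξ : Lists α L, ∑ η : Lists α L,
          listLik (fun i => r' i (t i)) ξ * listLik (fun i => s' i (t i)) η * f ξ η
        - ∑ t : α → τ, (∏ i, w (t i)) * ∑ ξ : Lists α L, ∑ η : Lists α L,
          listLik (fun i => r i (t i)) ξ * listLik (fun i => s i (t i)) η * f ξ η) ^ 2
      ≤ 1 / 100 := by
  have hmix : ∀ (r s : α → τ → ℝ) (L : ℕ) (f : Lists α L → Lists α L → ℝ),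
      ∑ t : α → τ, (∏ i, w (t i)) * ∑ ξ : Lists α L, ∑ η : Lists α L,
          listLik (fun i => r i (t i)) ξ * listLik (fun i => s i (t i)) η * f ξ η
      = ∑ ξ : Lists α L, ∑ η : Lists α L, listWeight ξ * listWeight η *
        (∏ i, cellLik w (r i) (s i) (counts ξ.2 i) (counts η.2 i)) * f ξ η := by
    intro r s L f
    simp only [← sum_prior_listLik, Finset.mul_sum, Finset.sum_mul]
    rw [Finset.sum_comm]
    refine Finset.sum_congr rfl fun ξ _ => ?_
    rw [Finset.sum_comm]
    exact Finset.sum_congr rfl fun η _ => Finset.sum_congr rfl fun t _ => by ring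
  set F : α → ℕ → ℕ → ℝ := fun i => cellLik w (r i) (s i) with hFdef
  set G : α → ℕ → ℕ → ℝ := fun i => cellLik w (r' i) (s' i) with hGdef
  -- As L grows the truncated masses tend to 1 and the second moment bound tends to (1 + χ)^|α| - 1.
  have hlim : Tendsto (fun L => ∏ i, (2 * cellSum L (G i) - cellSum L (F i) + χ)
      - 2 * ∏ i, cellSum L (G i) + ∏ i, cellSum L (F i)) atTop
      (𝓝 (∏ _i : α, (2 * 1 - 1 + χ) - 2 * ∏ _i : α, 1 + ∏ _i : α, (1 : ℝ))) := by
    have hG := fun i => tendsto_cellSum_cellLik hw (r' i) (s' i)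
    have hF := fun i => tendsto_cellSum_cellLik hw (r i) (s i)
    refine ((tendsto_finsetProd _ fun i _ => ?_).sub
      ((tendsto_finsetProd _ fun i _ => hG i).const_mul 2)).add
      (tendsto_finsetProd _ fun i _ => hF i)
    exact (((hG i).const_mul 2).sub (hF i)).add tendsto_const_nhds
  have hval : ∏ _i : α, (2 * 1 - 1 + χ) - 2 * ∏ _i : α, 1 + ∏ _i : α, (1 : ℝ) < 1 / 100 := by
    simp only [Finset.prod_const_one, Finset.prod_const, Finset.card_univ]
    have hχ0 : 0 ≤ χ ∨ Fintype.card α = 0 := by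
      by_cases h : Nonempty α
      · left
        obtain ⟨i⟩ := h
        exact le_trans (cellSum_nonneg fun a b => div_nonneg (sq_nonneg _) (hF i a b).le) (hχ i 0)
      · right
        rw [not_nonempty_iff] at h
        exact Fintype.card_eq_zero
    have h1 : (2 * 1 - 1 + χ) ^ Fintype.card α ≤ Real.exp (1 / 200) := by
      rcases hχ0 with h | h
      · calc (2 * 1 - 1 + χ) ^ Fintype.card α ≤ Real.exp χ ^ Fintype.card α := by
              refine pow_le_pow_left₀ (by linarith) ?_ _
              linarith [Real.add_one_le_exp χ]
          _ = Real.exp (Fintype.card α * χ) := by rw [Real.exp_nat_mul]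
          _ ≤ _ := Real.exp_le_exp.2 hcard
      · rw [h, pow_zero]; exact Real.one_le_exp (by norm_num)
    have h2 : Real.exp (1 / 200) < 101 / 100 := by
      have h3 : 1 - 1 / 200 ≤ Real.exp (-(1 / 200)) := by
        linarith [Real.add_one_le_exp (-(1 / 200 : ℝ))]
      have h4 : Real.exp (-(1 / 200)) * Real.exp (1 / 200) = 1 := by rw [← Real.exp_add]; simp
      nlinarith [Real.exp_pos (1 / 200)]
    linarith
  filter_upwards [hlim.eventually_lt_const hval] with L hL f hf0 hf1
  rw [hmix, hmix, ← Finset.sum_sub_distrib]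
  have h1 := sq_lists_sub_le L F G hF f hf0 hf1
  have hF1 : ∏ i, cellSum L (F i) ≤ 1 := Finset.prod_le_one
    (fun i _ => cellSum_nonneg fun a b => (hF i a b).le)
    (fun i _ => cellSum_cellLik_le_one hw0 hw (hr i) (hs i) L)
  have hF0 : 0 ≤ ∏ i, cellSum L (F i) :=
    Finset.prod_nonneg fun i _ => cellSum_nonneg fun a b => (hF i a b).le
  have h2 : ∏ i, cellSum L (fun a b => G i a b ^ 2 / F i a b)
      ≤ ∏ i, (2 * cellSum L (G i) - cellSum L (F i) + χ) := by
    refine Finset.prod_le_prod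
      (fun i _ => cellSum_nonneg fun a b => div_nonneg (sq_nonneg _) (hF i a b).le) (fun i _ => ?_)
    rw [cellSum_sq_div (hF i)]
    linarith [hχ i L]
  have h3 : ∑ ξ : Lists α L, (∑ η : Lists α L, listWeight ξ * listWeight η *
        (∏ i, cellLik w (r' i) (s' i) (counts ξ.2 i) (counts η.2 i)) * f ξ η
      - ∑ η : Lists α L, listWeight ξ * listWeight η *
        (∏ i, cellLik w (r i) (s i) (counts ξ.2 i) (counts η.2 i)) * f ξ η)
      = ∑ ξ : Lists α L, ∑ η : Lists α L, listWeight ξ * listWeight η *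
        (∏ i, G i (counts ξ.2 i) (counts η.2 i)
          - ∏ i, F i (counts ξ.2 i) (counts η.2 i)) * f ξ η := by
    refine Finset.sum_congr rfl fun ξ _ => ?_
    rw [← Finset.sum_sub_distrib]
    exact Finset.sum_congr rfl fun η _ => by ring
  rw [h3]
  refine h1.trans ?_
  nlinarith

/-! ### Running fixed-size tests on Poisson sequences -/

/-- The probability that a Poisson variable with mean `σ` lies between `m` and `L`. -/
noncomputable def poissonMid (m L : ℕ) (σ : ℝ) : ℝ :=
  ∑ N ∈ Finset.range (L + 1), if m ≤ N then Real.exp (-σ) * (σ ^ N / (N.factorial : ℝ)) else 0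

theorem poissonMid_nonneg (m L : ℕ) {σ : ℝ} (hσ : 0 ≤ σ) : 0 ≤ poissonMid m L σ :=
  Finset.sum_nonneg fun N _ => by split_ifs <;> positivity

theorem poissonMid_le_one (m L : ℕ) {σ : ℝ} (hσ : 0 ≤ σ) : poissonMid m L σ ≤ 1 := by
  refine le_trans ?_ (poissonCdf_le_one L hσ)
  rw [poissonCdf, Finset.mul_sum]
  refine Finset.sum_le_sum fun N _ => ?_
  split_ifs
  · exact le_rfl
  · positivity

/-- For N < m one has σ^N ≤ 2^m (σ/2)^N, so the lengths below m have probability at most 2^m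
exp(-σ/2). -/
theorem poissonCdf_sub_le_poissonMid (m L : ℕ) {σ : ℝ} (hσ : 0 ≤ σ) :
    poissonCdf L σ - 2 ^ m * Real.exp (-(σ / 2)) ≤ poissonMid m L σ := by
  have h1 : poissonCdf L σ ≤ poissonMid m L σ + Real.exp (-σ) * (2 ^ m *
      ∑ N ∈ Finset.range (L + 1), (σ / 2) ^ N / (N.factorial : ℝ)) := by
    rw [poissonCdf, poissonMid, Finset.mul_sum, Finset.mul_sum, Finset.mul_sum,
      ← Finset.sum_add_distrib]
    refine Finset.sum_le_sum fun N _ => ?_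
    split_ifs with h
    · have : 0 ≤ Real.exp (-σ) * (2 ^ m * ((σ / 2) ^ N / (N.factorial : ℝ))) := by positivity
      linarith
    · rw [zero_add]
      gcongr
      rw [← mul_div_assoc]
      gcongr
      rw [div_pow, ← mul_div_assoc, le_div_iff₀ (by positivity), mul_comm]
      gcongr
      · norm_num
      · omega
  have h2 : Real.exp (-σ) * (2 ^ m * ∑ N ∈ Finset.range (L + 1), (σ / 2) ^ N / (N.factorial : ℝ))
      ≤ Real.exp (-σ) * (2 ^ m * Real.exp (σ / 2)) := by
    gcongr
    exact Real.sum_le_exp_of_nonneg (by positivity) _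
  have h3 : Real.exp (-σ) * (2 ^ m * Real.exp (σ / 2)) = 2 ^ m * Real.exp (-(σ / 2)) := by
    rw [mul_left_comm, ← Real.exp_add]; congr 2; ring
  linarith

/-- Evaluating a function on the first `m` samples of a Poisson process. -/
theorem sum_listLik_prefix {α : Type*} [Fintype α] {L m : ℕ} {r : α → ℝ} (hr : 0 < ∑ i, r i)
    (φ : (Fin m → α) → ℝ) :
    ∑ ξ : Lists α L, listLik r ξ *
        (if h : m ≤ ξ.1.1 then φ (fun j => ξ.2 (Fin.castLE h j)) else 0)
      = poissonMid m L (∑ i, r i) * ∑ x : Fin m → α, (∏ j, (r (x j) / ∑ i, r i)) * φ x := by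
  rw [Fintype.sum_sigma]
  simp only [listLik, listWeight]
  set σ := ∑ i, r i with hσ
  have h1 : ∀ N : ℕ, ∑ x : Fin N → α, 1 / (N.factorial : ℝ) * (Real.exp (-σ) * ∏ j, r (x j)) *
        (if h : m ≤ N then φ (fun j => x (Fin.castLE h j)) else 0)
      = (if m ≤ N then Real.exp (-σ) * (σ ^ N / (N.factorial : ℝ)) else 0) *
        ∑ x : Fin m → α, (∏ j, (r (x j) / σ)) * φ x := by
    intro N
    split_ifs with h
    swap
    · simp
    -- The k unused samples sum freely to σ^k; the remaining σ^m normalises the first m rates.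
    obtain ⟨k, rfl⟩ := Nat.exists_eq_add_of_le h
    rw [sum_fin_add_fun, Finset.mul_sum]
    refine Finset.sum_congr rfl fun A _ => ?_
    have h2 : ∀ B : Fin k → α, 1 / ((m + k).factorial : ℝ) * (Real.exp (-σ) *
        ∏ j, r (Fin.append A B j)) * φ (fun j => Fin.append A B (Fin.castLE h j))
        = 1 / ((m + k).factorial : ℝ) * Real.exp (-σ) * (∏ j, r (A j)) * φ A * ∏ j, r (B j) := by
      intro B
      have h3 : (fun j => Fin.append A B (Fin.castLE h j)) = A := by
        ext j
        exact Fin.append_left A B j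
      rw [h3]
      simp only [Fin.prod_univ_add, Fin.append_left, Fin.append_right]
      ring
    simp only [h2]
    rw [← Finset.mul_sum, ← Fintype.sum_pow, ← hσ, Finset.prod_div_distrib, Finset.prod_const,
      Finset.card_univ, Fintype.card_fin, pow_add]
    field_simp
  simp only [h1]
  rw [← Finset.sum_mul, poissonMid]
  congr 1
  exact Fin.sum_univ_eq_sum_range
    (fun N => if m ≤ N then Real.exp (-σ) * (σ ^ N / (N.factorial : ℝ)) else 0) (L + 1)

/-- A test on prefixes of two sequences, rejecting sequences that are too short. -/
noncomputable def prefixTest {α : Type*} {m m' : ℕ} (L : ℕ)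
    (φ : (Fin m → α) → (Fin m' → α) → ℝ) (ξ η : Lists α L) : ℝ :=
  if h : m ≤ ξ.1.1 then
    if h' : m' ≤ η.1.1 then
      φ (fun j => ξ.2 (Fin.castLE h j)) (fun j => η.2 (Fin.castLE h' j))
    else 0
  else 0

theorem sum_listLik_prefixTest {α : Type*} [Fintype α] {L m m' : ℕ} {r s : α → ℝ}
    (hr : 0 < ∑ i, r i) (hs : 0 < ∑ i, s i) (φ : (Fin m → α) → (Fin m' → α) → ℝ) :
    ∑ ξ : Lists α L, ∑ η : Lists α L, listLik r ξ * listLik s η * prefixTest L φ ξ η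
      = poissonMid m L (∑ i, r i) * poissonMid m' L (∑ i, s i) *
        ∑ x : Fin m → α, ∑ y : Fin m' → α,
          (∏ j, (r (x j) / ∑ i, r i)) * (∏ j, (s (y j) / ∑ i, s i)) * φ x y := by
  have h1 : ∀ ξ : Lists α L, ∑ η : Lists α L, listLik r ξ * listLik s η * prefixTest L φ ξ η
      = listLik r ξ * (if h : m ≤ ξ.1.1 then poissonMid m' L (∑ i, s i) *
        ∑ y : Fin m' → α, (∏ j, (s (y j) / ∑ i, s i)) * φ (fun j => ξ.2 (Fin.castLE h j)) y
          else 0) := by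
    intro ξ
    simp only [mul_assoc]
    rw [← Finset.mul_sum]
    congr 1
    by_cases h : m ≤ ξ.1.1
    · simp only [prefixTest, h, dif_pos]
      exact sum_listLik_prefix hs (φ (fun j => ξ.2 (Fin.castLE h j)))
    · simp [prefixTest, h]
  simp only [h1]
  rw [sum_listLik_prefix hr (fun x => poissonMid m' L (∑ i, s i) *
    ∑ y : Fin m' → α, (∏ j, (s (y j) / ∑ i, s i)) * φ x y), mul_assoc]
  congr 1
  rw [Finset.mul_sum]
  refine Finset.sum_congr rfl fun x _ => ?_
  rw [mul_left_comm, Finset.mul_sum]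
  congr 1
  exact Finset.sum_congr rfl fun y _ => by ring

/-! ### The hard instance with heavy and light elements -/

/-- The distribution proportional to the rates `r`. -/
noncomputable def normDist {n : ℕ} (r : Fin n → ℝ) (hr : ∀ i, 0 ≤ r i) (hpos : 0 < ∑ i, r i) :
    Dist n :=
  ⟨fun i => r i / ∑ i, r i, fun i => div_nonneg (hr i) hpos.le, by
    rw [← Finset.sum_div, div_self hpos.ne']⟩

theorem l1Dist_comm {n : ℕ} (p q : Dist n) : l1Dist p q = l1Dist q p := by
  simp only [l1Dist, abs_sub_comm]

/-- Both distributions have mass 1, so the excess of p on A is matched by an equal excess of q off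
A. -/
theorem two_mul_sum_le_l1Dist {n : ℕ} (p q : Dist n) (A : Finset (Fin n))
    (hq : ∀ i ∈ A, q.1 i = 0) : 2 * ∑ i ∈ A, p.1 i ≤ l1Dist p q := by
  have hp1 := p.2.2
  have hq1 := q.2.2
  have h0 : ∑ i ∈ A, q.1 i = 0 := Finset.sum_eq_zero hq
  rw [← Finset.sum_add_sum_compl A] at hp1 hq1
  rw [l1Dist, ← Finset.sum_add_sum_compl A]
  have h1 : ∑ i ∈ A, (p.1 i - q.1 i) ≤ ∑ i ∈ A, |p.1 i - q.1 i| :=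
    Finset.sum_le_sum fun i _ => le_abs_self _
  have h2 : ∑ i ∈ Aᶜ, (q.1 i - p.1 i) ≤ ∑ i ∈ Aᶜ, |p.1 i - q.1 i| :=
    Finset.sum_le_sum fun i _ => by rw [abs_sub_comm]; exact le_abs_self _
  rw [Finset.sum_sub_distrib] at h1 h2
  linarith

/-- The unknown normalisation is harmless: with a the unshared rate on A, ε (c + a) ≤ a + a. -/
theorem le_l1Dist_normDist {n : ℕ} {r s : Fin n → ℝ} (hr : ∀ i, 0 ≤ r i) (hrpos : 0 < ∑ i, r i)
    (hs : ∀ i, 0 ≤ s i) (hspos : 0 < ∑ i, s i) (A : Finset (Fin n)) (hA : ∀ i ∈ A, s i = 0)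
    {c ε : ℝ} (hε1 : ε ≤ 1) (hc : ∑ i, r i ≤ c + ∑ i ∈ A, r i) (hεc : ε * c ≤ ∑ i ∈ A, r i)
    (hε0 : 0 ≤ ε) : ε ≤ l1Dist (normDist r hr hrpos) (normDist s hs hspos) := by
  refine le_trans ?_ (two_mul_sum_le_l1Dist _ _ A fun i hi => by simp [normDist, hA i hi])
  simp only [normDist]
  rw [← Finset.sum_div, ← mul_div_assoc, le_div_iff₀ hrpos]
  have ha : 0 ≤ ∑ i ∈ A, r i := Finset.sum_nonneg fun i _ => hr i
  calc ε * ∑ i, r i ≤ ε * (c + ∑ i ∈ A, r i) := mul_le_mul_of_nonneg_left hc hε0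
    _ ≤ 2 * ∑ i ∈ A, r i := by nlinarith

/-- The prior of the state of an element: it is heavy with probability `ρ`, and it has a uniformly
random sign. -/
noncomputable def prior (ρ : ℝ) (u : Bool × Bool) : ℝ := (if u.1 then ρ else 1 - ρ) / 2

/-- The common rate of both distributions in the close case. -/
noncomputable def closeRate {n : ℕ} [NeZero n] (M l : ℝ) (i : Fin n) (u : Bool × Bool) : ℝ :=
  if i = 0 then M else if u.1 then 1 else l

/-- The rates in the far case: light elements belong to only one of the two distributions. -/
noncomputable def farRate {n : ℕ} [NeZero n] (M l : ℝ) (b : Bool) (i : Fin n)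
    (u : Bool × Bool) : ℝ :=
  if i = 0 then M else if u.1 then 1 else if u.2 = b then 2 * l else 0

theorem sum_prior (ρ : ℝ) : ∑ u, prior ρ u = 1 := by
  simp [prior, Fintype.sum_prod_type]

theorem prior_nonneg {ρ : ℝ} (h0 : 0 ≤ ρ) (h1 : ρ ≤ 1) (u : Bool × Bool) : 0 ≤ prior ρ u := by
  unfold prior; split_ifs <;> linarith

theorem closeRate_nonneg {n : ℕ} [NeZero n] {M l : ℝ} (hM : 0 ≤ M) (hl : 0 ≤ l) (i : Fin n)
    (u : Bool × Bool) : 0 ≤ closeRate M l i u := by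
  unfold closeRate; split_ifs <;> linarith

theorem farRate_nonneg {n : ℕ} [NeZero n] {M l : ℝ} (hM : 0 ≤ M) (hl : 0 ≤ l) (b : Bool) (i : Fin n)
    (u : Bool × Bool) : 0 ≤ farRate M l b i u := by
  unfold farRate; split_ifs <;> linarith

theorem le_sum_of_zero {n : ℕ} [NeZero n] {M : ℝ} {r : Fin n → ℝ} (hr : ∀ i, 0 ≤ r i)
    (h0 : r 0 = M) : M ≤ ∑ i, r i :=
  h0 ▸ Finset.single_le_sum (fun i _ => hr i) (Finset.mem_univ (0 : Fin n))

/-- Replacing the rates (l, l) by (2l, 0) or (0, 2l) with equal odds preserves all moments of total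
order at most 1, so the first discrepancy is of order l². -/
theorem abs_light_moment_sub_le {l : ℝ} (hl0 : 0 ≤ l) (hl1 : 2 * l ≤ 1) (a b : ℕ) :
    |((2 * l) ^ a * 0 ^ b + 0 ^ a * (2 * l) ^ b) / 2 - l ^ a * l ^ b| ≤ 4 * l ^ 2 := by
  have hl2 : l ≤ 1 := by linarith
  have hpow : ∀ c, (2 * l) ^ (c + 2) ≤ 4 * l ^ 2 := fun c => by
    calc (2 * l) ^ (c + 2) ≤ (2 * l) ^ 2 :=
          pow_le_pow_of_le_one (by linarith) hl1 (by omega)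
      _ = _ := by ring
  have hpow' : ∀ c, l ^ (c + 2) ≤ 4 * l ^ 2 := fun c => by
    calc l ^ (c + 2) ≤ l ^ 2 := pow_le_pow_of_le_one hl0 hl2 (by omega)
      _ ≤ _ := by nlinarith [sq_nonneg l]
  have hn : ∀ c, 0 ≤ (2 * l) ^ c := fun c => by positivity
  have hn' : ∀ c, 0 ≤ l ^ c := fun c => by positivity
  rcases a with _ | a <;> rcases b with _ | b
  · norm_num; positivity
  · rcases b with _ | b
    · norm_num; positivity
    · have h1 := hpow b; have h2 := hpow' b; have h3 := hn (b + 2); have h4 := hn' (b + 2)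
      have : ((2 * l) ^ 0 * 0 ^ (b + 1 + 1) + 0 ^ 0 * (2 * l) ^ (b + 1 + 1)) / 2
          - l ^ 0 * l ^ (b + 1 + 1) = (2 * l) ^ (b + 2) / 2 - l ^ (b + 2) := by simp
      rw [this, abs_le]; constructor <;> linarith
  · rcases a with _ | a
    · norm_num; positivity
    · have h1 := hpow a; have h2 := hpow' a; have h3 := hn (a + 2); have h4 := hn' (a + 2)
      have : ((2 * l) ^ (a + 1 + 1) * 0 ^ 0 + 0 ^ (a + 1 + 1) * (2 * l) ^ 0) / 2
          - l ^ (a + 1 + 1) * l ^ 0 = (2 * l) ^ (a + 2) / 2 - l ^ (a + 2) := by simp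
      rw [this, abs_le]; constructor <;> linarith
  · have h2 := hpow' (a + b); have h4 := hn' (a + b + 2)
    have : ((2 * l) ^ (a + 1) * 0 ^ (b + 1) + 0 ^ (a + 1) * (2 * l) ^ (b + 1)) / 2
        - l ^ (a + 1) * l ^ (b + 1) = - l ^ (a + b + 2) := by
      rw [← pow_add]; simp; ring
    rw [this, abs_neg, abs_of_nonneg h4]; exact h2

section
variable {n : ℕ} [NeZero n] {M l ρ : ℝ}

theorem cellLik_closeRate_pos (hM : 0 < M) (hl : 0 ≤ l) (hρ0 : 0 < ρ) (hρ1 : ρ ≤ 1) (i : Fin n)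
    (a b : ℕ) : 0 < cellLik (prior ρ) (closeRate M l i) (closeRate M l i) a b := by
  refine Finset.sum_pos' (fun u _ => mul_nonneg (prior_nonneg hρ0.le hρ1 u)
    (mul_nonneg (Real.exp_pos _).le (mul_nonneg (pow_nonneg (closeRate_nonneg hM.le hl i u) a)
      (pow_nonneg (closeRate_nonneg hM.le hl i u) b)))) ⟨(true, true), Finset.mem_univ _, ?_⟩
  have h1 : 0 < closeRate M l i (true, true) := by
    by_cases h : i = 0 <;> simp [closeRate, h, hM]
  have h2 : 0 < prior ρ (true, true) := by simp [prior, hρ0]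
  positivity

/-- The `χ²`-divergence of a single element. -/
theorem cellSum_chiSq_le (hl0 : 0 ≤ l) (hl1 : 2 * l ≤ 1) (hρ0 : 0 < ρ) (hρ1 : ρ ≤ 1)
    (i : Fin n) (L : ℕ) :
    cellSum L (fun a b => (cellLik (prior ρ) (farRate M l true i) (farRate M l false i) a b
        - cellLik (prior ρ) (closeRate M l i) (closeRate M l i) a b) ^ 2
      / cellLik (prior ρ) (closeRate M l i) (closeRate M l i) a b) ≤ 1296 * l ^ 4 / ρ := by
  by_cases hi : i = 0
  · have : ∀ a b, cellLik (prior ρ) (farRate M l true i) (farRate M l false i) a b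
        = cellLik (prior ρ) (closeRate M l i) (closeRate M l i) a b := by
      intro a b
      simp [cellLik, farRate, closeRate, hi]
    simp only [this, sub_self]
    simp only [cellSum, ne_eq, OfNat.ofNat_ne_zero, not_false_eq_true, zero_pow, zero_div, mul_zero,
      Finset.sum_const_zero]
    positivity
  have hF : ∀ a b, cellLik (prior ρ) (closeRate M l i) (closeRate M l i) a b
      = ρ * Real.exp (-2) + (1 - ρ) * Real.exp (-(2 * l)) * (l ^ a * l ^ b) := by
    intro a b
    simp [cellLik, closeRate, hi, prior, Fintype.sum_prod_type]
    rw [two_mul l, show (-1 + -1 : ℝ) = -2 by norm_num, neg_add]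
    ring
  have hG : ∀ a b, cellLik (prior ρ) (farRate M l true i) (farRate M l false i) a b
      = ρ * Real.exp (-2) + (1 - ρ) * Real.exp (-(2 * l)) *
        (((2 * l) ^ a * 0 ^ b + 0 ^ a * (2 * l) ^ b) / 2) := by
    intro a b
    simp [cellLik, farRate, hi, prior, Fintype.sum_prod_type]
    rw [show (-1 + -1 : ℝ) = -2 by norm_num]
    ring
  have he1 : Real.exp 1 ≤ 3 := by linarith [Real.exp_one_lt_d9]
  have he2 : Real.exp 2 ≤ 9 := by
    rw [show (2 : ℝ) = 1 + 1 by norm_num, Real.exp_add]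
    nlinarith [Real.exp_pos 1]
  have hb : ∀ a b, (cellLik (prior ρ) (farRate M l true i) (farRate M l false i) a b
        - cellLik (prior ρ) (closeRate M l i) (closeRate M l i) a b) ^ 2
      / cellLik (prior ρ) (closeRate M l i) (closeRate M l i) a b ≤ 144 * l ^ 4 / ρ := by
    intro a b
    have hD : |cellLik (prior ρ) (farRate M l true i) (farRate M l false i) a b
        - cellLik (prior ρ) (closeRate M l i) (closeRate M l i) a b| ≤ 4 * l ^ 2 := by
      rw [hF, hG]
      have : ρ * Real.exp (-2) + (1 - ρ) * Real.exp (-(2 * l)) *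
          (((2 * l) ^ a * 0 ^ b + 0 ^ a * (2 * l) ^ b) / 2) - (ρ * Real.exp (-2)
          + (1 - ρ) * Real.exp (-(2 * l)) * (l ^ a * l ^ b)) = ((1 - ρ) * Real.exp (-(2 * l))) *
          (((2 * l) ^ a * 0 ^ b + 0 ^ a * (2 * l) ^ b) / 2 - l ^ a * l ^ b) := by ring
      rw [this, abs_mul]
      refine le_trans (mul_le_of_le_one_left (abs_nonneg _) ?_)
        (abs_light_moment_sub_le hl0 hl1 a b)
      rw [abs_mul, abs_of_nonneg (sub_nonneg.2 hρ1), Real.abs_exp]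
      exact mul_le_one₀ (by linarith) (Real.exp_pos _).le (Real.exp_le_one_iff.2 (by linarith))
    -- The masking: a heavy element alone gives every pair of counts likelihood at least ρ exp(-2),
    -- up to factorials.
    have hFl : ρ / 9 ≤ cellLik (prior ρ) (closeRate M l i) (closeRate M l i) a b := by
      rw [hF]
      have h1 : 1 / 9 ≤ Real.exp (-2) := by
        rw [Real.exp_neg, ← one_div]
        exact one_div_le_one_div_of_le (Real.exp_pos 2) he2
      have h2 : 0 ≤ (1 - ρ) * Real.exp (-(2 * l)) * (l ^ a * l ^ b) := by
        have := sub_nonneg.2 hρ1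
        positivity
      nlinarith
    calc _ ≤ (4 * l ^ 2) ^ 2 / (ρ / 9) := by
          refine div_le_div₀ (by positivity) ?_ (by positivity) hFl
          exact sq_le_sq' (abs_le.1 hD).1 (abs_le.1 hD).2
      _ = 144 * l ^ 4 / ρ := by field_simp; ring
  -- The factorial weights sum to at most e ≤ 3 in each variable, so 1296 = 9 · 144.
  have hs : ∑ a ∈ Finset.range (L + 1), 1 / (a.factorial : ℝ) ≤ 3 := by
    refine le_trans ?_ he1
    simpa using Real.sum_le_exp_of_nonneg zero_le_one (L + 1)
  have hs0 : 0 ≤ ∑ a ∈ Finset.range (L + 1), 1 / (a.factorial : ℝ) :=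
    Finset.sum_nonneg fun _ _ => by positivity
  calc _ ≤ ∑ a ∈ Finset.range (L + 1), ∑ b ∈ Finset.range (L + 1),
        1 / (a.factorial : ℝ) * (1 / (b.factorial : ℝ)) * (144 * l ^ 4 / ρ) := by
        refine Finset.sum_le_sum fun a _ => Finset.sum_le_sum fun b _ => ?_
        exact mul_le_mul_of_nonneg_left (hb a b) (by positivity)
    _ = ((∑ a ∈ Finset.range (L + 1), 1 / (a.factorial : ℝ)) *
        ∑ b ∈ Finset.range (L + 1), 1 / (b.factorial : ℝ)) * (144 * l ^ 4 / ρ) := by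
        rw [Finset.sum_mul_sum]
        simp only [Finset.sum_mul]
    _ ≤ (3 * 3) * (144 * l ^ 4 / ρ) := by gcongr
    _ = _ := by ring

/-- The number of heavy elements. -/
def heavyCount (t : Fin n → Bool × Bool) : ℝ := ∑ i, if (t i).1 then (1 : ℝ) else 0

/-- With few heavy elements the two distributions of the far case are far apart. -/
theorem isFar_farRate {N : ℝ} (hN : N + 1 = n) {ε : ℝ} (hε0 : 0 ≤ ε) (hε1 : ε ≤ 1) (hM : 0 < M)
    (hMN : 100 * M ≤ N) (hl : l * N = 42 * ε * M) (hl0 : 0 ≤ l) (t : Fin n → Bool × Bool)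
    (ht : heavyCount t ≤ 20 * M)
    (hr : ∀ i, 0 ≤ farRate M l true i (t i)) (hrpos : 0 < ∑ i, farRate M l true i (t i))
    (hs : ∀ i, 0 ≤ farRate M l false i (t i)) (hspos : 0 < ∑ i, farRate M l false i (t i)) :
    IsFar ε (normDist _ hr hrpos) (mixtures (normDist _ hs hspos) (normDist _ hs hspos)) := by
  intro x hx
  rw [eq_of_mem_mixtures_self hx]
  set A : Bool → Finset (Fin n) := fun b =>
    Finset.univ.filter fun i => i ≠ 0 ∧ (t i).1 = false ∧ (t i).2 = b with hA
  have hAsum : ∀ b, ∑ i ∈ A b, farRate M l b i (t i)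
      = ∑ i, if i ≠ 0 ∧ (t i).1 = false ∧ (t i).2 = b then 2 * l else 0 := by
    intro b
    rw [hA, Finset.sum_filter]
    refine Finset.sum_congr rfl fun i _ => ?_
    split_ifs with h
    · simp [farRate, h.1, h.2.1, h.2.2]
    · rfl
  have hzero : ∀ b, ∀ i ∈ A b, farRate M l (!b) i (t i) = 0 := by
    intro b i hi
    have h := (Finset.mem_filter.1 hi).2
    simp [farRate, h.1, h.2.1, h.2.2]
  -- Outside its own light elements a distribution has rate M from element 0 and at most 20 M from
  -- heavy elements.
  have htot : ∀ b, ∑ i, farRate M l b i (t i) ≤ 21 * M + ∑ i ∈ A b, farRate M l b i (t i) := by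
    intro b
    have h1 : ∑ i, farRate M l b i (t i) ≤ ∑ i, ((if i = 0 then M else 0)
        + (if (t i).1 then (1 : ℝ) else 0)
        + (if i ≠ 0 ∧ (t i).1 = false ∧ (t i).2 = b then 2 * l else 0)) := by
      refine Finset.sum_le_sum fun i _ => ?_
      by_cases h0 : i = 0
      · simp only [farRate, h0]
        split_ifs <;> simp_all
      · by_cases h1 : (t i).1
        · simp [farRate, h0, h1]
        · by_cases h2 : (t i).2 = b <;> simp [farRate, h0, h1, h2]
    rw [Finset.sum_add_distrib, Finset.sum_add_distrib, ← hAsum, Finset.sum_ite_eq'] at h1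
    simp only [Finset.mem_univ, if_true] at h1
    have : ∑ i, (if (t i).1 then (1 : ℝ) else 0) ≤ 20 * M := ht
    linarith
  -- At most N/2 elements are heavy, so the light ones carry at least l N in total. The larger side
  -- then has at least 21 ε M, which is ε times the bound 21 M above.
  have hsum : 42 * ε * M ≤ ∑ i ∈ A true, farRate M l true i (t i)
      + ∑ i ∈ A false, farRate M l false i (t i) := by
    have h1 : ∑ _i : Fin n, 2 * l ≤ ∑ i : Fin n, ((if i = 0 then 2 * l else 0)
        + 2 * l * (if (t i).1 then (1 : ℝ) else 0)
        + (if i ≠ 0 ∧ (t i).1 = false ∧ (t i).2 = true then 2 * l else 0)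
        + (if i ≠ 0 ∧ (t i).1 = false ∧ (t i).2 = false then 2 * l else 0)) := by
      refine Finset.sum_le_sum fun i _ => ?_
      by_cases h0 : i = 0
      · by_cases h1 : (t i).1 <;> simp [h0] <;> split_ifs <;> linarith
      · by_cases h1 : (t i).1
        · simp [h0, h1]
        · by_cases h2 : (t i).2 <;> simp [h0, h1, h2]
    rw [Finset.sum_add_distrib, Finset.sum_add_distrib, Finset.sum_add_distrib, ← hAsum, ← hAsum,
      Finset.sum_ite_eq', ← Finset.mul_sum (f := fun i => if (t i).1 then (1 : ℝ) else 0)] at h1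
    simp only [Finset.mem_univ, if_true, Finset.sum_const, Finset.card_univ, Fintype.card_fin,
      nsmul_eq_mul] at h1
    have h2 : ∑ i, (if (t i).1 then (1 : ℝ) else 0) ≤ N / 2 := ht.trans (by linarith)
    rw [← hN] at h1
    nlinarith [mul_le_mul_of_nonneg_left h2 hl0]
  rcases le_total (∑ i ∈ A false, farRate M l false i (t i))
    (∑ i ∈ A true, farRate M l true i (t i)) with h | h
  · exact le_l1Dist_normDist hr hrpos hs hspos (A true) (hzero true) hε1 (htot true)
      (by linarith) hε0
  · rw [l1Dist_comm]
    exact le_l1Dist_normDist hs hspos hr hrpos (A false) (hzero false) hε1 (htot false)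
      (by linarith) hε0

end

theorem expect_heavyCount (N : ℕ) (ρ : ℝ) :
    ∑ t : Fin (N + 1) → Bool × Bool, (∏ i, prior ρ (t i)) * heavyCount t = (N + 1) * ρ := by
  have h := iid_first_moment (sum_prior ρ) (fun u => if u.1 then (1 : ℝ) else 0) (N + 1)
  simp only [heavyCount]
  rw [h]
  push_cast
  congr 1
  simp [prior, Fintype.sum_prod_type]

/-! ### The lower bound from hidden collisions -/

theorem acceptProb_eq_sum_append {n m₀ m₁ m₂ : ℕ} (T : Algorithm n m₀ m₁ m₂) (p q : Dist n) :
    acceptProb T p q q = ∑ x : Fin m₀ → Fin n, ∑ y : Fin (m₁ + m₂) → Fin n,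
      (∏ j, p.1 (x j)) * (∏ j, q.1 (y j)) *
        (T x (fun j => y (Fin.castAdd m₂ j)) (fun j => y (Fin.natAdd m₁ j)) : ℝ) := by
  refine Finset.sum_congr rfl fun x _ => ?_
  rw [sum_fin_add_fun]
  refine Finset.sum_congr rfl fun y _ => Finset.sum_congr rfl fun z _ => ?_
  simp only [sampleProb, Fin.prod_univ_add, Fin.append_left, Fin.append_right]
  ring

theorem acceptProb_le_one {n m₀ m₁ m₂ : ℕ} (T : Algorithm n m₀ m₁ m₂) (p q₁ q₂ : Dist n) :
    acceptProb T p q₁ q₂ ≤ 1 := by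
  rw [acceptProb_eq_acceptGiven, ← sum_sampleProb p m₀]
  exact Finset.sum_le_sum fun x _ => mul_le_of_le_one_right (sampleProb_nonneg p x)
    (acceptGiven_le_one T q₁ q₂ x)

theorem acceptProb_nonneg {n m₀ m₁ m₂ : ℕ} (T : Algorithm n m₀ m₁ m₂) (p q₁ q₂ : Dist n) :
    0 ≤ acceptProb T p q₁ q₂ := by
  rw [acceptProb_eq_acceptGiven]
  exact Finset.sum_nonneg fun x _ => mul_nonneg (sampleProb_nonneg p x)
    (acceptGiven_nonneg T q₁ q₂ x)

theorem two_pow_mul_exp_le {m m' : ℕ} (hm : 1 ≤ m) (hm' : m' ≤ m) {σ : ℝ} (hσ : 10 * (m : ℝ) ≤ σ) :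
    2 ^ m' * Real.exp (-(σ / 2)) ≤ 1 / 50 := by
  have h5 : (100 : ℝ) ≤ Real.exp 5 := by
    have h1 : Real.exp 5 = Real.exp 1 ^ 5 := by rw [← Real.exp_nat_mul]; norm_num
    rw [h1]
    calc (100 : ℝ) ≤ 2.7 ^ 5 := by norm_num
      _ ≤ Real.exp 1 ^ 5 := by gcongr; linarith [Real.exp_one_gt_d9]
  calc 2 ^ m' * Real.exp (-(σ / 2)) ≤ 2 ^ m * Real.exp (m * (-5)) := by
        gcongr
        · norm_num
        · linarith
    _ = (2 * Real.exp (-5)) ^ m := by rw [mul_pow, Real.exp_nat_mul]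
    _ ≤ (2 * (1 / 100)) ^ m := by
        gcongr
        rw [Real.exp_neg, ← one_div]
        gcongr
    _ ≤ (2 * (1 / 100)) ^ 1 := pow_le_pow_of_le_one (by norm_num) (by norm_num) hm
    _ = 1 / 50 := by norm_num

/-- With too few samples there is no tester: the collisions of the light elements are hidden by
those of the heavy elements. -/
theorem no_tester_of_few_samples {N m₀ m₁ m₂ : ℕ} {ε : ℝ} (hε0 : 0 < ε) (hε1 : ε ≤ 1) {m : ℕ}
    (hm : m = m₀ + m₁ + m₂) (hm1 : 1 ≤ m) (hmN : 1000 * (m : ℝ) ≤ N)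
    (hmε : 10 ^ 16 * ((m : ℝ) ^ 3 * ε ^ 4) ≤ N ^ 2) (T : Algorithm (N + 1) m₀ m₁ m₂) :
    ¬ IsMixtureTester ε T := by
  intro hT
  have hm0 : (1 : ℝ) ≤ m := by exact_mod_cast hm1
  have hN0 : (1 : ℝ) ≤ N := by linarith
  -- Element 0 with rate M = 10 m makes sequences shorter than m unlikely whatever the prior draws.
  -- About M elements are heavy, light rates total order ε M, and the summed χ² is of order N l⁴ /
  -- ρ, that is, m³ε⁴ / N².
  set M : ℝ := 10 * m with hM
  set l : ℝ := 42 * ε * M / N with hl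
  set ρ : ℝ := M / N with hρ
  have hM0 : 0 < M := by linarith
  have hl0 : 0 ≤ l := by positivity
  have hl1 : 2 * l ≤ 1 := by
    rw [hl, ← mul_div_assoc, div_le_one (by linarith)]
    nlinarith
  have hρ0 : 0 < ρ := by positivity
  have hρ1 : ρ ≤ 1 := by rw [hρ, div_le_one (by linarith)]; linarith
  have hcard : (Fintype.card (Fin (N + 1)) : ℝ) * (1296 * l ^ 4 / ρ) ≤ 1 / 200 := by
    have h1 : (1296 * l ^ 4 / ρ) = 1296 * 42 ^ 4 * 1000 * (m ^ 3 * ε ^ 4) / N ^ 3 := by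
      rw [hl, hρ, hM]; field_simp; ring
    rw [h1, Fintype.card_fin, ← mul_div_assoc, div_le_iff₀ (by positivity)]
    push_cast
    have h2 : (N + 1 : ℝ) ≤ 2 * N := by linarith
    have h3 : 0 ≤ (m : ℝ) ^ 3 * ε ^ 4 := by positivity
    calc (N + 1 : ℝ) * (1296 * 42 ^ 4 * 1000 * (m ^ 3 * ε ^ 4))
        ≤ 2 * N * (1296 * 42 ^ 4 * 1000 * (m ^ 3 * ε ^ 4)) := by gcongr
      _ ≤ 2 * N * (1 / 400 * (10 ^ 16 * (m ^ 3 * ε ^ 4))) := by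
          gcongr ?_ * ?_
          linarith
      _ ≤ 2 * N * (1 / 400 * N ^ 2) := by gcongr
      _ = 1 / 200 * N ^ 3 := by ring
  have hr := fun (t : Fin (N + 1) → Bool × Bool) i => closeRate_nonneg hM0.le hl0 i (t i)
  have hr' := fun (b : Bool) (t : Fin (N + 1) → Bool × Bool) i =>
    farRate_nonneg hM0.le hl0 b i (t i)
  have hrM : ∀ t : Fin (N + 1) → Bool × Bool, M ≤ ∑ i, closeRate M l i (t i) := fun t =>
    le_sum_of_zero (hr t) (by simp [closeRate])
  have hrM' : ∀ (b : Bool) (t : Fin (N + 1) → Bool × Bool), M ≤ ∑ i, farRate M l b i (t i) :=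
    fun b t => le_sum_of_zero (hr' b t) (by simp [farRate])
  have hclose := poisson_mixtures_close (α := Fin (N + 1)) (prior_nonneg hρ0.le hρ1) (sum_prior ρ)
    (r := closeRate M l) (s := closeRate M l) (r' := farRate M l true) (s' := farRate M l false)
    (fun i u => closeRate_nonneg hM0.le hl0 i u) (fun i u => closeRate_nonneg hM0.le hl0 i u)
    (fun i a b => cellLik_closeRate_pos hM0 hl0 hρ0 hρ1 i a b)
    (fun i L => cellSum_chiSq_le hl0 hl1 hρ0 hρ1 i L) hcard
  have hcdf : ∀ᶠ L in atTop, ∀ t : Fin (N + 1) → Bool × Bool,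
      97 / 100 < poissonCdf L (∑ i, closeRate M l i (t i)) :=
    eventually_all.2 fun t => (tendsto_poissonCdf _).eventually_const_lt (by norm_num)
  obtain ⟨L, hL, hLcdf⟩ := (hclose.and hcdf).exists
  set φ : (Fin m₀ → Fin (N + 1)) → (Fin (m₁ + m₂) → Fin (N + 1)) → ℝ := fun x y =>
    (T x (fun j => y (Fin.castAdd m₂ j)) (fun j => y (Fin.natAdd m₁ j)) : ℝ) with hφ
  have hf0 : ∀ ξ η : Lists (Fin (N + 1)) L, 0 ≤ prefixTest L φ ξ η := by
    intro ξ η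
    unfold prefixTest
    split_ifs
    · exact (T _ _ _).2.1
    all_goals exact le_rfl
  have hf1 : ∀ ξ η : Lists (Fin (N + 1)) L, prefixTest L φ ξ η ≤ 1 := by
    intro ξ η
    unfold prefixTest
    split_ifs
    · exact (T _ _ _).2.2
    all_goals exact zero_le_one
  have hdiff := hL (prefixTest L φ) hf0 hf1
  have heval : ∀ (r s : Fin (N + 1) → ℝ) (hr : ∀ i, 0 ≤ r i) (hs : ∀ i, 0 ≤ s i)
      (hrpos : 0 < ∑ i, r i) (hspos : 0 < ∑ i, s i),
      ∑ ξ : Lists (Fin (N + 1)) L, ∑ η : Lists (Fin (N + 1)) L,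
        listLik r ξ * listLik s η * prefixTest L φ ξ η
      = poissonMid m₀ L (∑ i, r i) * poissonMid (m₁ + m₂) L (∑ i, s i) *
        acceptProb T (normDist r hr hrpos) (normDist s hs hspos) (normDist s hs hspos) := by
    intro r s hr hs hrpos hspos
    rw [sum_listLik_prefixTest hrpos hspos, acceptProb_eq_sum_append]
    rfl
  have hW0 : ∀ t : Fin (N + 1) → Bool × Bool, 0 ≤ ∏ i, prior ρ (t i) := fun t =>
    Finset.prod_nonneg fun i _ => prior_nonneg hρ0.le hρ1 _
  have hW1 : ∑ t : Fin (N + 1) → Bool × Bool, ∏ i, prior ρ (t i) = 1 :=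
    sum_prod_weight (sum_prior ρ) _
  have hyes : 3 / 5 ≤ ∑ t : Fin (N + 1) → Bool × Bool, (∏ i, prior ρ (t i)) *
      ∑ ξ : Lists (Fin (N + 1)) L, ∑ η : Lists (Fin (N + 1)) L,
        listLik (fun i => closeRate M l i (t i)) ξ * listLik (fun i => closeRate M l i (t i)) η *
          prefixTest L φ ξ η := by
    calc (3 / 5 : ℝ) = ∑ t : Fin (N + 1) → Bool × Bool, (∏ i, prior ρ (t i)) * (3 / 5) := by
          rw [← Finset.sum_mul, hW1, one_mul]
      _ ≤ _ := by
          refine Finset.sum_le_sum fun t _ => mul_le_mul_of_nonneg_left ?_ (hW0 t)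
          have hpos : 0 < ∑ i, closeRate M l i (t i) := hM0.trans_le (hrM t)
          rw [heval _ _ (hr t) (hr t) hpos hpos]
          have hacc := (hT (normDist _ (hr t) hpos) (normDist _ (hr t) hpos)
            (normDist _ (hr t) hpos)).1 (self_mem_mixtures _)
          have hmid : ∀ m', m' ≤ m → 95 / 100 ≤ poissonMid m' L (∑ i, closeRate M l i (t i)) := by
            intro m' hm'
            have h1 := poissonCdf_sub_le_poissonMid m' L hpos.le
            have h2 := two_pow_mul_exp_le hm1 hm' (hrM t)
            linarith [hLcdf t]
          have h1 := hmid m₀ (by omega)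
          have h2 := hmid (m₁ + m₂) (by omega)
          calc (3 / 5 : ℝ) ≤ (95 / 100) * (95 / 100) * (2 / 3) := by norm_num
            _ ≤ _ := by gcongr
  have hno : ∑ t : Fin (N + 1) → Bool × Bool, (∏ i, prior ρ (t i)) *
      ∑ ξ : Lists (Fin (N + 1)) L, ∑ η : Lists (Fin (N + 1)) L,
        listLik (fun i => farRate M l true i (t i)) ξ *
          listLik (fun i => farRate M l false i (t i)) η * prefixTest L φ ξ η ≤ 13 / 30 := by
    -- With more than 20 M heavy elements the instance need not be far; acceptance is then bounded
    -- by 1, at a cost of at most 1/10 by Markov.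
    calc _ ≤ ∑ t : Fin (N + 1) → Bool × Bool, (∏ i, prior ρ (t i)) *
          (1 / 3 + heavyCount t * (1 / (20 * M))) := by
          refine Finset.sum_le_sum fun t _ => mul_le_mul_of_nonneg_left ?_ (hW0 t)
          have hrpos : 0 < ∑ i, farRate M l true i (t i) := hM0.trans_le (hrM' true t)
          have hspos : 0 < ∑ i, farRate M l false i (t i) := hM0.trans_le (hrM' false t)
          rw [heval _ _ (hr' true t) (hr' false t) hrpos hspos]
          set p := normDist _ (hr' true t) hrpos with hp
          set q := normDist _ (hr' false t) hspos with hq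
          have h1 : poissonMid m₀ L (∑ i, farRate M l true i (t i)) *
              poissonMid (m₁ + m₂) L (∑ i, farRate M l false i (t i)) * acceptProb T p q q
              ≤ acceptProb T p q q :=
            mul_le_of_le_one_left (acceptProb_nonneg T p q q)
              (mul_le_one₀ (poissonMid_le_one _ _ hrpos.le) (poissonMid_nonneg _ _ hspos.le)
                (poissonMid_le_one _ _ hspos.le))
          refine h1.trans ?_
          have hH : 0 ≤ heavyCount t := Finset.sum_nonneg fun i _ => by split_ifs <;> norm_num
          rcases le_or_gt (heavyCount t) (20 * M) with h | h
          · have hfar := isFar_farRate (N := (N : ℝ)) (by push_cast; ring) hε0.le hε1 hM0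
              (by linarith) (by rw [hl]; field_simp) hl0 t h (hr' true t) hrpos (hr' false t) hspos
            have h2 := (hT p q q).2 hfar
            have : 0 ≤ heavyCount t * (1 / (20 * M)) := by positivity
            linarith
          · have h2 := acceptProb_le_one T p q q
            have : 1 ≤ heavyCount t * (1 / (20 * M)) := by
              rw [mul_one_div, one_le_div (by positivity)]; exact h.le
            linarith
      _ = 1 / 3 + (N + 1) * ρ * (1 / (20 * M)) := by
          simp only [mul_add, Finset.sum_add_distrib, ← mul_assoc, ← Finset.sum_mul]
          rw [hW1, expect_heavyCount, one_mul]
      _ ≤ 13 / 30 := by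
          have : (N + 1) * ρ * (1 / (20 * M)) = (N + 1) / (20 * N : ℝ) := by
            rw [hρ]; field_simp
          rw [this]
          have : ((N : ℝ) + 1) / (20 * N) ≤ 1 / 10 := by
            rw [div_le_iff₀ (by positivity)]; linarith
          linarith
  -- The gap 3/5 - 13/30 = 1/6 has square 1/36 > 1/100.
  nlinarith

/-! ### Combining the lower bounds -/

/-- Every tester uses at least a constant multiple of `rate n ε` samples. -/
theorem rate_le_samples {n : ℕ} {ε : ℝ} (hn : 2 ≤ n) (hε0 : 0 < ε) (hε1 : ε ≤ 1) {m₀ m₁ m₂ : ℕ}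
    {T : Algorithm n m₀ m₁ m₂} (hT : IsMixtureTester ε T) :
    1 / 10 ^ 7 * rate n ε ≤ ((m₀ + m₁ + m₂ : ℕ) : ℝ) := by
  obtain ⟨N, rfl⟩ : ∃ N, n = N + 1 := ⟨n - 1, by omega⟩
  have hN1 : (1 : ℝ) ≤ N := by exact_mod_cast (by omega : 1 ≤ N)
  have hS := sqrt_lower_bound hn hε0 hε1 hT
  set m := m₀ + m₁ + m₂ with hm
  have hmm : (m₀ : ℝ) ≤ m := by exact_mod_cast (by omega : m₀ ≤ m)
  set S : ℝ := √((N + 1 : ℕ) : ℝ) / ε ^ 2 with hSdef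
  set R : ℝ := ((N + 1 : ℕ) : ℝ) ^ (2 / 3 : ℝ) / ε ^ (4 / 3 : ℝ) with hR
  have hR3 : R ^ 3 = ((N + 1 : ℕ) : ℝ) ^ 2 / ε ^ 4 := two_thirds_term_pow_three (N + 1) hε0
  have hrate : rate (N + 1) ε = S + R := rfl
  have hS0 : 0 < S := by positivity
  have hR0 : 0 < R := by positivity
  have hmpos : (0 : ℝ) < m := by linarith
  have hm1 : 1 ≤ m := by exact_mod_cast hmpos
  have hRm : R ≤ 10 ^ 6 * m := by
    refine le_of_not_gt fun hlt => ?_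
    have hcube : (10 ^ 6 * (m : ℝ)) ^ 3 < R ^ 3 :=
      pow_lt_pow_left₀ hlt (by positivity) (by norm_num)
    rw [hR3] at hcube
    push_cast at hcube
    by_cases h1 : 1000 * (m : ℝ) ≤ N
    · refine no_tester_of_few_samples hε0 hε1 hm hm1 h1 ?_ T hT
      rw [lt_div_iff₀ (by positivity)] at hcube
      nlinarith
    -- When m is at least of order n, the first lower bound already suffices, because R³ = n S².
    · have hS2 : S ^ 2 = ((N + 1 : ℕ) : ℝ) / ε ^ 4 := by
        rw [hSdef, div_pow, Real.sq_sqrt (by positivity)]; ring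
      push_cast at hS2
      have h2 : ((N : ℝ) + 1) ^ 2 / ε ^ 4 = (N + 1) * S ^ 2 := by rw [hS2]; ring
      rw [h2] at hcube
      have h3 : S ^ 2 ≤ (6 * m) ^ 2 := by gcongr; linarith
      have h4 : (N + 1 : ℝ) ≤ 2000 * m := by linarith
      have h5 : (N + 1) * S ^ 2 ≤ 2000 * m * (6 * (m : ℝ)) ^ 2 := by gcongr
      have h6 : 0 < (m : ℝ) ^ 3 := by positivity
      nlinarith
  rw [hrate]
  linarith

end MixtureTesting

theorem mainTheorem2 :
    (∃ C : ℝ, 0 < C ∧ ∀ (n : ℕ) (ε : ℝ), 1 ≤ n → 0 < ε →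
      ∃ (m₀ m₁ m₂ : ℕ) (T : MixtureTesting.Algorithm n m₀ m₁ m₂),
        MixtureTesting.IsMixtureTester ε T ∧
        ((m₀ + m₁ + m₂ : ℕ) : ℝ) ≤ C * MixtureTesting.rate n ε) ∧
    (∃ c : ℝ, 0 < c ∧ ∀ (n : ℕ) (ε : ℝ), 2 ≤ n → 0 < ε → ε ≤ 1 →
      ∀ (m₀ m₁ m₂ : ℕ) (T : MixtureTesting.Algorithm n m₀ m₁ m₂),
        MixtureTesting.IsMixtureTester ε T →
        c * MixtureTesting.rate n ε ≤ ((m₀ + m₁ + m₂ : ℕ) : ℝ)) :=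
  ⟨MixtureTesting.exists_mixtureTester, 1 / 10 ^ 7, by norm_num,
    fun _ _ hn hε0 hε1 _ _ _ _ hT => MixtureTesting.rate_le_samples hn hε0 hε1 hT⟩
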